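/- Let $(Q,N,C_1,C_2,\dots)$ be a random vector with $Q$ and all $C_i$ real-valued and $N\in\{0,1,2,\dots\}$, and put $\rho_\gamma=E\big[\sum_{i=1}^N|C_i|^\gamma\big]$ for $\gamma>0$. Let $\beta>1$ be such that $E[|Q|^\beta]<\infty$ and $E\big[\big(\sum_{i=1}^N|C_i|\big)^\beta\big]<\infty$, and assume that either (i) $\max(\rho_1,\rho_\beta)<1$, or (ii) $\beta=2$, $\rho_1=1$, $\rho_\beta<1$ and $E[Q]=0$. Weighted branching process: let $U=\bigcup_{n\ge0}\{1,2,\dots\}^n$ and let $\{(Q_{\mathbf i},N_{\mathbf i},C_{(\mathbf i,1)},C_{(\mathbf i,2)},\dots)\}_{\mathbf i\in U}$ be i.i.d. copies of $(Q,N,C_1,C_2,\dots)$. Set $A_0=\{\emptyset\}$, $A_n=\{(\mathbf i,r):\mathbf i\in A_{n-1},\,1\le r\le N_{\mathbf i}\}$ for $n\ge1$, $\Pi_\emptyset=1$, $\Pi_{(\mathbf i,r)}=C_{(\mathbf i,r)}\Pi_{\mathbf i}$, and $$R^{(k)}=\sum_{j=0}^k\sum_{\mathbf i\in A_j}Q_{\mathbf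 i}\Pi_{\mathbf i},\qquad k\ge0.$$ Bootstrap pools: for $m\ge1$ let $\{(Q^{j}_i,N^{j}_i,C^{j}_{(i,1)},C^{j}_{(i,2)},\dots)\}_{j\ge0,\,1\le i\le m}$ be i.i.d. copies of $(Q,N,C_1,C_2,\dots)$, and, independently of them, let $\{s^{j}_{i,r}\}_{j\ge1,\,1\le i\le m,\,r\ge1}$ be i.i.d. uniform on $\{1,\dots,m\}$ (the joint behaviour for different $m$ is arbitrary). Set $\hat R^{(0,m)}_i=Q^{0}_i$ and, for $j\ge1$, $$\hat R^{(j,m)}_i=\sum_{r=1}^{N^{j}_i}C^{j}_{(i,r)}\,\hat R^{(j-1,m)}_{s^{j}_{i,r}}+Q^{j}_i,\qquad 1\le i\le m,$$ that is, the values on the right are sampled uniformly with replacement from the previous pool. Let $h:\mathbb R\to\mathbb R$ be continuous with $|h(x)|\le C(1+|x|)$ for all $x\in\mathbb R$ and some constant $C>0$. Then, for every $k\ge0$, the variables $h(R^{(k)})$ and $\frac1m\sum_{i=1}^m h(\hat R^{(k,m)}_i)$ are integrable, and $$\frac1m\sum_{i=1}^m h\big(\hat R^{(k,m)}_i\big)\;\longrightarrow\;E\big[h(R^{(k)})\big]\qquad\text{as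 } m\to\infty$$ in $L^1$, and hence in probability; that is, the pool average is a consistent estimator of $E[h(R^{(k)})]$. -/

import Mathlib

open MeasureTheory ProbabilityTheory Filter Topology
open scoped ENNReal

noncomputable section

namespace BranchingBootstrap

/-- The value space of a branching vector `(Q, N, C₁, C₂, …)`. The weights are indexed from `0`:
the entry `r` of the last component is `C_{r+1}`. -/
abbrev BranchVec : Type := ℝ × ℕ × (ℕ → ℝ)

/-- The component `Q`. -/
def BranchVec.Q (v : BranchVec) : ℝ := v.1

/-- The component `N`. -/
def BranchVec.N (v : BranchVec) : ℕ := v.2.1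

/-- The weights `C₁, C₂, …`, indexed from `0`. -/
def BranchVec.C (v : BranchVec) (r : ℕ) : ℝ := v.2.2 r

/-- `ρ_β = E[∑_{i=1}^N |C_i|^β]` for a generic branching vector of law `ν`. -/
def rho (ν : Measure BranchVec) (β : ℝ) : ℝ≥0∞ :=
  ∫⁻ v, ENNReal.ofReal (∑ r ∈ Finset.range (BranchVec.N v), |BranchVec.C v r| ^ β) ∂ν

/-- The moment conditions with exponent `β` on the law `ν` of the generic branching vector:
`E|Q|^β < ∞`, `E[(∑_{i=1}^N |C_i|)^β] < ∞`, and either (i) `ρ₁ ∨ ρ_β < 1`, or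
(ii) `β = 2`, `ρ₁ = 1`, `ρ_β < 1` and `E[Q] = 0`. -/
structure MomentConditions (ν : Measure BranchVec) (β : ℝ) : Prop where
  one_le : 1 ≤ β
  moment_Q : ∫⁻ v, ENNReal.ofReal (|BranchVec.Q v| ^ β) ∂ν < ∞
  moment_C : ∫⁻ v, ENNReal.ofReal
    ((∑ r ∈ Finset.range (BranchVec.N v), |BranchVec.C v r|) ^ β) ∂ν < ∞
  contraction : max (rho ν 1) (rho ν β) < 1 ∨
    (β = 2 ∧ rho ν 1 = 1 ∧ rho ν β < 1 ∧ ∫ v, BranchVec.Q v ∂ν = 0)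

/-! ### The weighted branching process

A node `(i₁, …, i_n)` is the list `[i_n - 1, …, i₁ - 1]`, the most recent index first, so that
`[]` is the root and `r :: i` is the `r`-th child `(i, r + 1)` of the node `i`. A realization of
the tree assigns a branching vector `v i = (Q_i, N_i, C_{(i,1)}, C_{(i,2)}, …)` to every node. -/

/-- The `n`-th generation `A_n` of the tree. -/
def generation (v : List ℕ → BranchVec) : ℕ → Finset (List ℕ)
  | 0 => {[]}
  | n + 1 => (generation v n).biUnion fun i =>
      (Finset.range (BranchVec.N (v i))).image fun r => r :: i

/-- The weight `Π_i` of a node: `Π_∅ = 1` and `Π_{(i,r)} = C_{(i,r)} Π_i`. -/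
def weight (v : List ℕ → BranchVec) : List ℕ → ℝ
  | [] => 1
  | r :: i => BranchVec.C (v i) r * weight v i

/-- `R^{(k)} = ∑_{j=0}^k ∑_{i ∈ A_j} Q_i Π_i`. -/
def treeSum (v : List ℕ → BranchVec) (k : ℕ) : ℝ :=
  ∑ j ∈ Finset.range (k + 1), ∑ i ∈ generation v j, BranchVec.Q (v i) * weight v i

/-- `V` is a family of i.i.d. branching vectors of law `ν`, indexed by the nodes. -/
structure IsBranchingFamily {Ω : Type*} [MeasurableSpace Ω] (P : Measure Ω)
    (ν : Measure BranchVec) (V : List ℕ → Ω → BranchVec) : Prop where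
  measurable : ∀ i, Measurable (V i)
  law : ∀ i, P.map (V i) = ν
  indep : iIndepFun V P

/-! ### The iterative bootstrap algorithm -/

/-- The sample pools produced by the algorithm with pool size `m`, as a function of its random
input: `b j i` is the branching vector simulated at level `j` for the `i`-th member of the pool,
and `s j i r` is the position in the pool of level `j - 1` from which the `r`-th value used for
the `i`-th member of the pool of level `j` is taken. -/
def pool {m : ℕ} (b : ℕ → Fin m → BranchVec) (s : ℕ → Fin m → ℕ → Fin m) : ℕ → Fin m → ℝ
  | 0, i => BranchVec.Q (b 0 i)
  | j + 1, i =>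
      (∑ r ∈ Finset.range (BranchVec.N (b (j + 1) i)),
        BranchVec.C (b (j + 1) i) r * pool b s j (s (j + 1) i r)) + BranchVec.Q (b (j + 1) i)

/-- The random input of a run of the algorithm with pool size `m`: the branching vectors are
i.i.d. of law `ν`, the resampling positions are i.i.d. uniform on the `m` positions, and the
two families are independent of each other. -/
structure IsBootstrapInput {Ω : Type*} [MeasurableSpace Ω] (P : Measure Ω)
    (ν : Measure BranchVec) {m : ℕ} (B : ℕ → Fin m → Ω → BranchVec)
    (S : ℕ → Fin m → ℕ → Ω → Fin m) : Prop where
  measurable_B : ∀ j i, Measurable (B j i)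
  measurable_S : ∀ j i r, Measurable (S j i r)
  law_B : ∀ j i, P.map (B j i) = ν
  law_S : ∀ j i r, P.map (S j i r) = uniformOn Set.univ
  indep_B : iIndepFun (fun (p : ℕ × Fin m) => B p.1 p.2) P
  indep_S : iIndepFun (fun (p : ℕ × Fin m × ℕ) => S p.1 p.2.1 p.2.2) P
  indep_B_S : IndepFun (fun ω (p : ℕ × Fin m) => B p.1 p.2 ω)
    (fun ω (p : ℕ × Fin m × ℕ) => S p.1 p.2.1 p.2.2 ω) P

/-- The estimator `(1/m) ∑_{i=1}^m h(R̂_i^{(k,m)})`. -/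
def poolAverage {Ω : Type*} (h : ℝ → ℝ) (k : ℕ) {m : ℕ} (B : ℕ → Fin m → Ω → BranchVec)
    (S : ℕ → Fin m → ℕ → Ω → Fin m) (ω : Ω) : ℝ :=
  (1 / (m : ℝ)) * ∑ i : Fin m, h (pool (fun j i => B j i ω) (fun j i r => S j i r ω) k i)

end BranchingBootstrap

end

/-! The law of `R^(k+1)` is the image of the law of `R^(k)` under the smoothing transform `smoothing
ν`. Given the pool of level `k`, the pool of level `k+1` consists of `m` i.i.d. draws from
`smoothing ν` of the empirical measure of the old pool. The bootstrap is therefore a noisy iteration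
of the same map.

By induction on `k`, the characteristic function of the empirical measure of the pool converges in
`L¹`, at each frequency, to that of `R^(k)` (`tendsto_lintegral_charFun_inputPool_sub`). One step
makes two errors. Sampling costs at most `2/√m`, by a variance bound. The inherited error is
controlled through `φ_{smoothing ν μ}(t) = E[e^{itQ} ∏_{r<N} φ_μ(t C_r)]`: given the branching
vector, the products differ by at most a finite sum of errors at the frequencies `t C_r`, and since
they are bounded by `1`, dominated convergence applies.

Lévy's theorem concerns deterministic measures, whereas here the measures are random. Averaging them
over an event, and filling in with the limit law outside it, gives deterministic probability
measures to which the theorem applies; the two sign events of the deviation then give `L¹`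
convergence for bounded continuous functions. Finally `h` is truncated, the cost being controlled by
moments of order `β > 1` bounded uniformly in `m` (`exists_moment_bound`). -/

namespace BranchingBootstrap

section Measurability

variable {α : Type*} [MeasurableSpace α]

lemma measurable_range_comp {M : Type*} [MeasurableSpace M] {F : ℕ → α → M}
    (hF : ∀ n, Measurable (F n)) {N : α → ℕ} (hN : Measurable N) :
    Measurable fun a => F (N a) a := by
  have h : Measurable fun p : ℕ × α => F p.1 p.2 :=
    measurable_from_prod_countable_right hF
  exact h.comp (hN.prodMk measurable_id)

@[fun_prop]
lemma BranchVec.measurable_Q : Measurable BranchVec.Q := measurable_fst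

@[fun_prop]
lemma BranchVec.measurable_N : Measurable BranchVec.N := measurable_snd.fst

@[fun_prop]
lemma BranchVec.measurable_C (r : ℕ) : Measurable fun v => BranchVec.C v r :=
  (measurable_pi_apply r).comp measurable_snd.snd

end Measurability

/-! ### The smoothing transform and its characteristic function -/

/-- The value `∑_{r ≤ N} C_r z_r + Q` obtained from a branching vector and values `z`. -/
def branchStep (v : BranchVec) (z : ℕ → ℝ) : ℝ :=
  (∑ r ∈ Finset.range (BranchVec.N v), BranchVec.C v r * z r) + BranchVec.Q v

@[fun_prop]
lemma measurable_branchStep :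
    Measurable fun p : BranchVec × (ℕ → ℝ) => branchStep p.1 p.2 := by
  unfold branchStep
  refine Measurable.add ?_ (by fun_prop)
  refine measurable_range_comp
    (F := fun n (p : BranchVec × (ℕ → ℝ)) => ∑ r ∈ Finset.range n, BranchVec.C p.1 r * p.2 r)
    (N := fun p => BranchVec.N p.1) (fun n => ?_) (by fun_prop)
  exact Finset.measurable_sum _ fun r _ =>
    ((BranchVec.measurable_C r).comp measurable_fst).mul (by fun_prop)

/-- The smoothing transform: the law of `∑_{r ≤ N} C_r z_r + Q`, where `(Q, N, C)` has law `ν` and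
the `z_r` are independent of it and i.i.d. of law `μ`. -/
noncomputable def smoothing (ν : Measure BranchVec) (μ : Measure ℝ) : Measure ℝ :=
  (ν.prod (Measure.infinitePi fun _ : ℕ => μ)).map fun p => branchStep p.1 p.2

instance (ν : Measure BranchVec) [IsProbabilityMeasure ν] (μ : Measure ℝ)
    [IsProbabilityMeasure μ] : IsProbabilityMeasure (smoothing ν μ) :=
  Measure.isProbabilityMeasure_map measurable_branchStep.aemeasurable

lemma integral_infinitePi_prod_range (μ : Measure ℝ) [IsProbabilityMeasure μ] (n : ℕ)
    (f : ℕ → ℝ → ℂ) (hf : ∀ r, Measurable (f r)) :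
    ∫ z, ∏ r ∈ Finset.range n, f r (z r) ∂(Measure.infinitePi fun _ : ℕ => μ)
      = ∏ r ∈ Finset.range n, ∫ x, f r x ∂μ := by
  have h := integral_restrict_infinitePi (μ := fun _ : ℕ => μ) (s := Finset.range n)
    (f := fun y => ∏ r : Finset.range n, f r (y r)) (Measurable.aestronglyMeasurable (by fun_prop))
  have h2 := integral_fintype_prod_eq_prod (μ := fun _ : Finset.range n => μ)
    (fun (r : Finset.range n) (x : ℝ) => f r x)
  rw [h2, Finset.prod_coe_sort (Finset.range n) fun r => ∫ x, f r x ∂μ] at h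
  rw [← h]
  refine integral_congr_ae (.of_forall fun z => ?_)
  exact (Finset.prod_coe_sort (Finset.range n) fun r => f r (z r)).symm

lemma norm_cexp_ofReal_mul_I_le (x : ℝ) : ‖Complex.exp (x * Complex.I)‖ ≤ 1 :=
  (Complex.norm_exp_ofReal_mul_I x).le

/-- For a fixed branching vector the new value is affine in the i.i.d. `z r`, so the integral over
`z` factorizes. -/
lemma charFun_smoothing (ν : Measure BranchVec) [IsProbabilityMeasure ν] (μ : Measure ℝ)
    [IsProbabilityMeasure μ] (t : ℝ) :
    charFun (smoothing ν μ) t = ∫ v, Complex.exp ((t * BranchVec.Q v : ℝ) * Complex.I) *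
      ∏ r ∈ Finset.range (BranchVec.N v), charFun μ (t * BranchVec.C v r) ∂ν := by
  have hm : Measurable fun p : BranchVec × (ℕ → ℝ) =>
      Complex.exp (t * (branchStep p.1 p.2 : ℝ) * Complex.I) := by fun_prop
  rw [charFun_apply_real, smoothing, integral_map (by fun_prop)
    (Measurable.aestronglyMeasurable (by fun_prop)), integral_prod]
  · refine integral_congr_ae (.of_forall fun v => ?_)
    simp only [charFun_apply_real]
    rw [← integral_infinitePi_prod_range μ (BranchVec.N v)
      (fun r x => Complex.exp ((t * BranchVec.C v r : ℝ) * x * Complex.I)) (by fun_prop),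
      ← integral_const_mul]
    refine integral_congr_ae (.of_forall fun z => ?_)
    simp only [branchStep, ← Complex.exp_sum, ← Complex.exp_add]
    congr 1
    push_cast
    rw [mul_add, add_mul, Finset.mul_sum, Finset.sum_mul, add_comm]
    congr 1
    refine Finset.sum_congr rfl fun r _ => by ring
  · refine Integrable.of_bound hm.aestronglyMeasurable 1 (.of_forall fun p => ?_)
    exact_mod_cast norm_cexp_ofReal_mul_I_le (t * branchStep p.1 p.2)

/-! ### Moments under the smoothing transform -/

lemma rpow_sum_mul_le {ι : Type*} (s : Finset ι) (c z : ι → ℝ≥0∞) {β : ℝ} (hβ : 1 ≤ β) :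
    (∑ r ∈ s, c r * z r) ^ β ≤ (∑ r ∈ s, c r) ^ (β - 1) * ∑ r ∈ s, c r * z r ^ β := by
  have hβ0 : 0 < β := by linarith
  -- Hölder's inequality with weights `c r`, raised to the power `β`.
  have h := ENNReal.rpow_le_rpow
    (ENNReal.inner_le_weight_mul_Lp_of_nonneg s hβ c z) hβ0.le
  rwa [ENNReal.mul_rpow_of_nonneg _ _ hβ0.le, ← ENNReal.rpow_mul, ← ENNReal.rpow_mul,
    inv_mul_cancel₀ hβ0.ne', ENNReal.rpow_one, sub_mul, one_mul, inv_mul_cancel₀ hβ0.ne'] at h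

lemma lintegral_rpow_branchStep_le (μ : Measure ℝ) [IsProbabilityMeasure μ] {β : ℝ} (hβ : 1 ≤ β)
    (v : BranchVec) :
    ∫⁻ z, ‖branchStep v z‖ₑ ^ β ∂(Measure.infinitePi fun _ : ℕ => μ) ≤
      2 ^ (β - 1) * ((∑ r ∈ Finset.range (BranchVec.N v), ‖BranchVec.C v r‖ₑ) ^ β *
        ∫⁻ x, ‖x‖ₑ ^ β ∂μ + ‖BranchVec.Q v‖ₑ ^ β) := by
  have hβ0 : 0 ≤ β := by linarith
  set c := fun r => ‖BranchVec.C v r‖ₑ with hc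
  set s := Finset.range (BranchVec.N v)
  have hpt (z : ℕ → ℝ) : ‖branchStep v z‖ₑ ^ β ≤
      2 ^ (β - 1) * ((∑ r ∈ s, c r) ^ (β - 1) * ∑ r ∈ s, c r * ‖z r‖ₑ ^ β
        + ‖BranchVec.Q v‖ₑ ^ β) := by
    calc ‖branchStep v z‖ₑ ^ β ≤ (∑ r ∈ s, c r * ‖z r‖ₑ + ‖BranchVec.Q v‖ₑ) ^ β := by
          refine ENNReal.rpow_le_rpow ((enorm_add_le _ _).trans ?_) hβ0
          gcongr
          refine (enorm_sum_le _ _).trans (Finset.sum_le_sum fun r _ => ?_)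
          rw [enorm_mul]
      _ ≤ 2 ^ (β - 1) * ((∑ r ∈ s, c r * ‖z r‖ₑ) ^ β + ‖BranchVec.Q v‖ₑ ^ β) :=
          ENNReal.rpow_add_le_mul_rpow_add_rpow _ _ hβ
      _ ≤ _ := by gcongr; exact rpow_sum_mul_le s c _ hβ
  refine (lintegral_mono hpt).trans_eq ?_
  rw [lintegral_const_mul _ (by fun_prop), lintegral_add_right _ measurable_const,
    lintegral_const_mul _ (by fun_prop), lintegral_finsetSum _ (by fun_prop), lintegral_const,
    measure_univ, mul_one]
  have (r : ℕ) : ∫⁻ z : ℕ → ℝ, c r * ‖z r‖ₑ ^ β ∂(Measure.infinitePi fun _ : ℕ => μ)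
      = c r * ∫⁻ x, ‖x‖ₑ ^ β ∂μ := by
    rw [lintegral_const_mul _ (by fun_prop),
      ← (measurePreserving_eval_infinitePi (fun _ : ℕ => μ) r).lintegral_comp (by fun_prop)]
  simp_rw [this]
  rw [← Finset.sum_mul, ← mul_assoc ((∑ r ∈ s, c r) ^ (β - 1))]
  congr 4
  -- Each `z r` has the same `β`-moment, so a further factor `∑ c r` comes out and completes the
  -- exponent `β - 1` to `β`. Nonnegativity of both exponents covers the values `0` and `∞`.
  conv_lhs => rw [← ENNReal.rpow_one (∑ r ∈ s, c r)]
  rw [← ENNReal.rpow_mul, one_mul,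
    ← ENNReal.rpow_add_of_nonneg _ _ (by linarith) zero_le_one, sub_add_cancel]

lemma lintegral_rpow_smoothing_le (ν : Measure BranchVec) [IsProbabilityMeasure ν] (μ : Measure ℝ)
    [IsProbabilityMeasure μ] {β : ℝ} (hβ : 1 ≤ β) :
    ∫⁻ x, ‖x‖ₑ ^ β ∂(smoothing ν μ) ≤
      2 ^ (β - 1) * ((∫⁻ v, (∑ r ∈ Finset.range (BranchVec.N v), ‖BranchVec.C v r‖ₑ) ^ β ∂ν) *
        ∫⁻ x, ‖x‖ₑ ^ β ∂μ + ∫⁻ v, ‖BranchVec.Q v‖ₑ ^ β ∂ν) := by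
  have hmC : Measurable fun v : BranchVec =>
      (∑ r ∈ Finset.range (BranchVec.N v), ‖BranchVec.C v r‖ₑ) ^ β :=
    (measurable_range_comp (F := fun n v => ∑ r ∈ Finset.range n, ‖BranchVec.C v r‖ₑ)
      (fun n => by fun_prop) BranchVec.measurable_N).pow_const β
  rw [smoothing, lintegral_map (by fun_prop) (by fun_prop), lintegral_prod _ (by fun_prop)]
  refine (lintegral_mono fun v => lintegral_rpow_branchStep_le μ hβ v).trans_eq ?_
  rw [lintegral_const_mul _ (by fun_prop), lintegral_add_left (by fun_prop),
    lintegral_mul_const _ hmC]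

/-! ### Empirical measures -/

/-- The empirical measure of the entries of a vector. -/
noncomputable def empirical {m : ℕ} (x : Fin m → ℝ) : Measure ℝ :=
  (uniformOn (Set.univ : Set (Fin m))).map x

instance {m : ℕ} [NeZero m] (x : Fin m → ℝ) : IsProbabilityMeasure (empirical x) :=
  Measure.isProbabilityMeasure_map (measurable_of_countable x).aemeasurable

lemma uniformOn_univ_fin_eq_smul_count (m : ℕ) :
    uniformOn (Set.univ : Set (Fin m)) = (m : ℝ≥0∞)⁻¹ • Measure.count := by
  simp [uniformOn, ProbabilityTheory.cond]

lemma lintegral_empirical {m : ℕ} (x : Fin m → ℝ) {f : ℝ → ℝ≥0∞} (hf : Measurable f) :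
    ∫⁻ y, f y ∂(empirical x) = (m : ℝ≥0∞)⁻¹ * ∑ i, f (x i) := by
  rw [empirical, lintegral_map hf (measurable_of_countable x), uniformOn_univ_fin_eq_smul_count,
    lintegral_smul_measure, lintegral_count, tsum_fintype, smul_eq_mul]

lemma charFun_empirical {m : ℕ} (x : Fin m → ℝ) (t : ℝ) :
    charFun (empirical x) t = (m : ℂ)⁻¹ * ∑ i, Complex.exp ((t * x i : ℝ) * Complex.I) := by
  rw [charFun_apply_real, empirical, integral_map (measurable_of_countable x).aemeasurable
    (Measurable.aestronglyMeasurable (by fun_prop)), uniformOn_univ_fin_eq_smul_count,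
    integral_smul_measure, integral_count]
  simp [Complex.real_smul]

/-! ### Independence of disjoint subfamilies -/

lemma comap_pi_le_iSup_range {Ω ι α 𝓧 : Type*} [MeasurableSpace 𝓧] (X : ι → Ω → 𝓧) (f : α → ι) :
    MeasurableSpace.comap (fun ω a => X (f a) ω) MeasurableSpace.pi ≤
      ⨆ i ∈ Set.range f, MeasurableSpace.comap (X i) inferInstance := by
  rw [MeasurableSpace.pi, MeasurableSpace.comap_iSup]
  refine iSup_le fun a => ?_
  rw [MeasurableSpace.comap_comp]
  exact le_iSup₂_of_le (f a) ⟨a, rfl⟩ le_rfl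

lemma indepFun_of_disjoint_range {Ω ι α γ 𝓧 : Type*} [MeasurableSpace Ω] [MeasurableSpace 𝓧]
    {P : Measure Ω} {X : ι → Ω → 𝓧} (hX : ∀ i, Measurable (X i)) (hind : iIndepFun X P)
    (f : α → ι) (g : γ → ι) (hfg : ∀ a c, f a ≠ g c) :
    IndepFun (fun ω a => X (f a) ω) (fun ω c => X (g c) ω) P := by
  have key := indep_iSup_of_disjoint (fun i => (hX i).comap_le) hind.iIndep
    (S := Set.range f) (T := Set.range g)
    (Set.disjoint_left.2 (by rintro _ ⟨a, rfl⟩ ⟨c, hc⟩; exact hfg a c hc.symm))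
  rw [IndepFun_iff_Indep]
  exact indep_of_indep_of_le_left
    (indep_of_indep_of_le_right key (comap_pi_le_iSup_range X g)) (comap_pi_le_iSup_range X f)

lemma prod_map_right {α β γ : Type*} [MeasurableSpace α] [MeasurableSpace β] [MeasurableSpace γ]
    (μ : Measure α) [SFinite μ] (σ : Measure β) [SFinite σ] {f : β → γ} (hf : Measurable f) :
    μ.prod (σ.map f) = (μ.prod σ).map fun p => (p.1, f p.2) := by
  conv_lhs => rw [← Measure.map_id (μ := μ)]
  rw [Measure.map_prod_map _ _ measurable_id hf]
  rfl

/-! ### The tree recursion and the law of the tree sum -/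

lemma sum_generation_succ_top (v : List ℕ → BranchVec) (n : ℕ) (f : List ℕ → ℝ) :
    ∑ i ∈ generation v (n + 1), f i =
      ∑ i ∈ generation v n, ∑ r ∈ Finset.range (BranchVec.N (v i)), f (r :: i) := by
  rw [generation, Finset.sum_biUnion]
  · refine Finset.sum_congr rfl fun i _ => ?_
    rw [Finset.sum_image]
    intro a _ b _ h
    exact (List.cons.inj h).1
  · intro i _ j _ hij
    simp only [Function.onFun, Finset.disjoint_left, Finset.mem_image]
    rintro _ ⟨r, _, rfl⟩ ⟨r', _, h⟩
    exact hij (List.cons.inj h).2.symm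

/-- `generation` grows at the leaves, but the smoothing transform acts at the root. Lists carry the
most recent index first, so the subtree of the root's child `r` consists of the nodes `i ++ [r]`. -/
lemma sum_generation_succ_root (n : ℕ) (v : List ℕ → BranchVec) (f : List ℕ → ℝ) :
    ∑ i ∈ generation v (n + 1), f i =
      ∑ r ∈ Finset.range (BranchVec.N (v [])),
        ∑ i ∈ generation (fun i => v (i ++ [r])) n, f (i ++ [r]) := by
  induction n generalizing f with
  | zero => rw [sum_generation_succ_top]; simp [generation]
  | succ n ih =>
    rw [sum_generation_succ_top, ih]
    refine Finset.sum_congr rfl fun r _ => ?_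
    rw [sum_generation_succ_top]
    simp

lemma weight_append_singleton (v : List ℕ → BranchVec) (r : ℕ) (i : List ℕ) :
    weight v (i ++ [r]) = BranchVec.C (v []) r * weight (fun i => v (i ++ [r])) i := by
  induction i with
  | nil => simp [weight]
  | cons a i ih => rw [List.cons_append, weight, ih, weight]; ring

lemma treeSum_zero (v : List ℕ → BranchVec) : treeSum v 0 = BranchVec.Q (v []) := by
  simp [treeSum, generation, weight]

lemma treeSum_succ (v : List ℕ → BranchVec) (k : ℕ) :
    treeSum v (k + 1) = branchStep (v []) fun r => treeSum (fun i => v (i ++ [r])) k := by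
  rw [treeSum, Finset.sum_range_succ', branchStep]
  congr 1
  · simp_rw [treeSum, sum_generation_succ_root, weight_append_singleton, Finset.mul_sum]
    rw [Finset.sum_comm]
    refine Finset.sum_congr rfl fun r _ => Finset.sum_congr rfl fun j _ =>
      Finset.sum_congr rfl fun i _ => by ring
  · simp [generation, weight]

lemma measurable_treeSum (k : ℕ) : Measurable fun v : List ℕ → BranchVec => treeSum v k := by
  induction k with
  | zero => simp only [treeSum_zero]; fun_prop
  | succ k ih =>
    simp only [treeSum_succ]
    have h : Measurable fun (v : List ℕ → BranchVec) (r : ℕ) =>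
        treeSum (fun i => v (i ++ [r])) k :=
      measurable_pi_lambda _ fun r =>
        ih.comp (measurable_pi_lambda _ fun i => measurable_pi_apply _)
    exact measurable_branchStep.comp ((measurable_pi_apply ([] : List ℕ)).prodMk h)

/-- The laws of the `R^{(k)}`: the iterates of the smoothing transform on the law of `Q`. -/
noncomputable def treeLaw (ν : Measure BranchVec) : ℕ → Measure ℝ
  | 0 => ν.map BranchVec.Q
  | k + 1 => smoothing ν (treeLaw ν k)

instance (ν : Measure BranchVec) [IsProbabilityMeasure ν] (k : ℕ) :
    IsProbabilityMeasure (treeLaw ν k) := by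
  induction k with
  | zero => exact Measure.isProbabilityMeasure_map BranchVec.measurable_Q.aemeasurable
  | succ k ih => rw [treeLaw]; infer_instance

/-- The branching property: the root vector is independent of the subtrees at its children, and
these are i.i.d. copies of the whole tree. Independence holds because no `i ++ [r]` is the root; the
joint law of the subtrees follows from injectivity of `(r, i) ↦ i ++ [r]`. -/
lemma infinitePi_map_subtrees (ν : Measure BranchVec) [IsProbabilityMeasure ν] :
    (Measure.infinitePi fun _ : List ℕ => ν).map (fun v => (v [], fun r i => v (i ++ [r]))) =
      ν.prod (Measure.infinitePi fun _ : ℕ => Measure.infinitePi fun _ : List ℕ => ν) := by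
  set M := Measure.infinitePi fun _ : List ℕ => ν
  have hind : iIndepFun (fun (i : List ℕ) (v : List ℕ → BranchVec) => v i) M :=
    iIndepFun_infinitePi (X := fun _ x => x) (fun _ => measurable_id)
  have h := indepFun_of_disjoint_range (by fun_prop) hind (fun _ : Unit => ([] : List ℕ))
    (fun p : ℕ × List ℕ => p.2 ++ [p.1]) (by simp)
  have h2 : IndepFun (fun v : List ℕ → BranchVec => v [])
      (fun v (r : ℕ) (i : List ℕ) => v (i ++ [r])) M :=
    h.comp (φ := fun x : Unit → BranchVec => x ()) (ψ := MeasurableEquiv.curry ℕ (List ℕ) BranchVec)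
      (by fun_prop) (by fun_prop)
  have hm : Measurable fun (v : List ℕ → BranchVec) (r : ℕ) (i : List ℕ) => v (i ++ [r]) :=
    measurable_pi_lambda _ fun r => measurable_pi_lambda _ fun i => measurable_pi_apply _
  rw [(indepFun_iff_map_prod_eq_prod_map_map (measurable_pi_apply _).aemeasurable
    hm.aemeasurable).1 h2]
  congr 1
  · exact Measure.infinitePi_map_eval (fun _ : List ℕ => ν) []
  · rw [← Measure.infinitePi_map_curry (fun (_ : ℕ) (_ : List ℕ) => ν),
      ← Measure.map_infinitePi_infinitePi_of_inj (P := fun _ : List ℕ => ν)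
        (f := fun p : ℕ × List ℕ => p.2 ++ [p.1]), Measure.map_map (by fun_prop) (by fun_prop)]
    · rfl
    · rintro ⟨a, i⟩ ⟨b, j⟩ h
      have := List.append_inj' h rfl
      simp_all

lemma infinitePi_map_treeSum (ν : Measure BranchVec) [IsProbabilityMeasure ν] (k : ℕ) :
    (Measure.infinitePi fun _ : List ℕ => ν).map (fun v => treeSum v k) = treeLaw ν k := by
  induction k with
  | zero =>
    simp only [treeSum_zero, treeLaw]
    conv_rhs => rw [← Measure.infinitePi_map_eval (fun _ : List ℕ => ν) []]
    rw [Measure.map_map (by fun_prop) (by fun_prop)]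
    rfl
  | succ k ih =>
    have hm := measurable_treeSum k
    have hm2 : Measurable fun (w : ℕ → List ℕ → BranchVec) (r : ℕ) => treeSum (w r) k :=
      measurable_pi_lambda _ fun r => hm.comp (measurable_pi_apply r)
    rw [treeLaw, smoothing, ← ih,
      ← Measure.infinitePi_map_pi (fun _ : ℕ => Measure.infinitePi fun _ : List ℕ => ν)
        (f := fun _ v => treeSum v k) (fun _ => hm)]
    have hm3 : Measurable fun (v : List ℕ → BranchVec) =>
        (v [], fun (r : ℕ) (i : List ℕ) => v (i ++ [r])) :=
      (measurable_pi_apply _).prodMk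
        (measurable_pi_lambda _ fun r => measurable_pi_lambda _ fun i => measurable_pi_apply _)
    have hm4 : Measurable fun p : BranchVec × (ℕ → List ℕ → BranchVec) =>
        (p.1, fun r => treeSum (p.2 r) k) := measurable_fst.prodMk (hm2.comp measurable_snd)
    rw [prod_map_right _ _ hm2, ← infinitePi_map_subtrees,
      Measure.map_map hm4 hm3, Measure.map_map (by fun_prop) (hm4.comp hm3)]
    congr 1
    ext v
    simp [treeSum_succ]

lemma IsBranchingFamily.map_treeSum {Ω : Type*} [MeasurableSpace Ω] {P : Measure Ω}
    {ν : Measure BranchVec} [IsProbabilityMeasure ν] {V : List ℕ → Ω → BranchVec}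
    (hV : IsBranchingFamily P ν V) (k : ℕ) :
    P.map (fun ω => treeSum (fun i => V i ω) k) = treeLaw ν k := by
  have h := hV.indep.map_fun_eq_infinitePi_map hV.measurable
  simp_rw [hV.law] at h
  rw [← infinitePi_map_treeSum, ← h, Measure.map_map (measurable_treeSum k)
    (measurable_pi_iff.2 hV.measurable)]
  rfl

/-! ### The pools as a Markov chain -/

lemma infinitePi_prod_infinitePi_map_zip {ι α β : Type*} [MeasurableSpace α] [MeasurableSpace β]
    (μ : Measure α) [IsProbabilityMeasure μ] (σ : Measure β) [IsProbabilityMeasure σ] :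
    ((Measure.infinitePi fun _ : ι => μ).prod (Measure.infinitePi fun _ : ι => σ)).map
      (fun p i => (p.1 i, p.2 i)) = Measure.infinitePi fun _ : ι => μ.prod σ := by
  -- Both measures are determined by their finite-dimensional marginals, where the claim is a
  -- rearrangement of a finite product.
  refine IsProjectiveLimit.unique (fun I => ?_)
    (Measure.isProjectiveLimit_infinitePi fun _ : ι => μ.prod σ)
  rw [← (measurePreserving_arrowProdEquivProdArrow α β I (fun _ => μ) (fun _ => σ)).symm.map_eq,
    ← Measure.infinitePi_map_restrict (fun _ : ι => μ),
    ← Measure.infinitePi_map_restrict (fun _ : ι => σ),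
    Measure.map_prod_map _ _ (by fun_prop) (by fun_prop),
    Measure.map_map (by fun_prop) (by fun_prop), Measure.map_map (by fun_prop) (by fun_prop)]
  rfl

section Pool

variable {m : ℕ}

lemma pool_succ (b : ℕ → Fin m → BranchVec) (s : ℕ → Fin m → ℕ → Fin m) (k : ℕ) (i : Fin m) :
    pool b s (k + 1) i = branchStep (b (k + 1) i) fun r => pool b s k (s (k + 1) i r) := rfl

lemma pool_congr {b b' : ℕ → Fin m → BranchVec} {s s' : ℕ → Fin m → ℕ → Fin m} {k : ℕ}
    (hb : ∀ j ≤ k, b j = b' j) (hs : ∀ j ≤ k, s j = s' j) : pool b s k = pool b' s' k := by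
  induction k with
  | zero => ext i; simp [pool, hb 0 le_rfl]
  | succ k ih =>
    ext i
    rw [pool_succ, pool_succ, hb _ le_rfl, hs _ le_rfl,
      ih (fun j hj => hb j (hj.trans k.le_succ)) (fun j hj => hs j (hj.trans k.le_succ))]

/-- The pool of level `k` as a function of all the random input. -/
noncomputable def inputPool (k : ℕ) (Z : ℕ × Fin m → BranchVec × (ℕ → Fin m)) : Fin m → ℝ :=
  pool (fun j i => (Z (j, i)).1) (fun j i => (Z (j, i)).2) k

/-- The next value of a member of the pool as a function of the current pool and its input. -/
noncomputable def poolStep (x : Fin m → ℝ) (y : BranchVec × (ℕ → Fin m)) : ℝ :=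
  branchStep y.1 fun r => x (y.2 r)

lemma measurable_poolStep :
    Measurable fun p : (Fin m → ℝ) × (BranchVec × (ℕ → Fin m)) => poolStep p.1 p.2 := by
  refine measurable_branchStep.comp (Measurable.prodMk (by fun_prop) ?_)
  refine measurable_pi_lambda _ fun r => ?_
  have h : Measurable fun p : Fin m × (Fin m → ℝ) => p.2 p.1 :=
    measurable_from_prod_countable_right fun i => measurable_pi_apply i
  exact h.comp (f := fun p : (Fin m → ℝ) × (BranchVec × (ℕ → Fin m)) => (p.2.2 r, p.1))
    (by fun_prop)

lemma inputPool_succ (k : ℕ) (Z : ℕ × Fin m → BranchVec × (ℕ → Fin m)) :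
    inputPool (k + 1) Z = fun i => poolStep (inputPool k Z) (Z (k + 1, i)) := rfl

lemma measurable_inputPool (k : ℕ) : Measurable (inputPool (m := m) k) := by
  induction k with
  | zero => exact measurable_pi_lambda _ fun i => by unfold inputPool pool; fun_prop
  | succ k ih =>
    refine measurable_pi_lambda _ fun i => ?_
    exact measurable_poolStep.comp (ih.prodMk (by fun_prop))

/-- Clamping the level at `k` shows that the pool of level `k` depends only on coordinates of level
at most `k`, the form needed for independence from level `k + 1`. -/
lemma inputPool_eq_min (k : ℕ) (Z : ℕ × Fin m → BranchVec × (ℕ → Fin m)) :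
    inputPool k Z = inputPool k fun p => Z (min p.1 k, p.2) :=
  pool_congr (fun j hj => by simp [min_eq_left hj]) (fun j hj => by simp [min_eq_left hj])

variable (m) in
/-- The law of the input of one member of the pool at one level. -/
noncomputable def inputLaw (ν : Measure BranchVec) : Measure (BranchVec × (ℕ → Fin m)) :=
  ν.prod (Measure.infinitePi fun _ : ℕ => uniformOn Set.univ)

instance [NeZero m] (ν : Measure BranchVec) [IsProbabilityMeasure ν] :
    IsProbabilityMeasure (inputLaw m ν) := by unfold inputLaw; infer_instance

/-- Uniform sampling with replacement from `x` is i.i.d. sampling from the empirical measure of `x`.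
-/
lemma map_poolStep [NeZero m] (ν : Measure BranchVec) [IsProbabilityMeasure ν] (x : Fin m → ℝ) :
    (inputLaw m ν).map (poolStep x) = smoothing ν (empirical x) := by
  have hx : Measurable x := measurable_of_countable x
  have hx2 : Measurable fun (s : ℕ → Fin m) (r : ℕ) => x (s r) :=
    measurable_pi_lambda _ fun r => hx.comp (measurable_pi_apply r)
  rw [smoothing, inputLaw]
  unfold empirical
  rw [← Measure.infinitePi_map_pi (fun _ : ℕ => uniformOn (Set.univ : Set (Fin m)))
      (f := fun _ => x) fun _ => hx]
  rw [prod_map_right _ _ hx2, Measure.map_map (by fun_prop) (by fun_prop)]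
  rfl

lemma infinitePi_map_inputPool_prod [NeZero m] (ν : Measure BranchVec) [IsProbabilityMeasure ν]
    (k : ℕ) :
    (Measure.infinitePi fun _ : ℕ × Fin m => inputLaw m ν).map
        (fun Z => (inputPool k Z, fun i => Z (k + 1, i))) =
      ((Measure.infinitePi fun _ : ℕ × Fin m => inputLaw m ν).map (inputPool k)).prod
        (Measure.pi fun _ => inputLaw m ν) := by
  set M := Measure.infinitePi fun _ : ℕ × Fin m => inputLaw m ν
  have hm := measurable_inputPool (m := m) k
  have hind : iIndepFun (fun (p : ℕ × Fin m) (Z : ℕ × Fin m → BranchVec × (ℕ → Fin m)) => Z p) M :=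
    iIndepFun_infinitePi (X := fun _ x => x) (fun _ => measurable_id)
  have h := (indepFun_of_disjoint_range (by fun_prop) hind (fun p : ℕ × Fin m => (min p.1 k, p.2))
    (fun i : Fin m => (k + 1, i)) (by rintro ⟨j, i⟩ c h; simp at h; omega)).comp hm measurable_id
  have h2 : IndepFun (inputPool k) (fun Z i => Z (k + 1, i)) M := by
    have he : inputPool k = inputPool k ∘
        fun (Z : ℕ × Fin m → BranchVec × (ℕ → Fin m)) p => Z (min p.1 k, p.2) :=
      funext fun Z => inputPool_eq_min k Z
    rw [he]
    exact h
  have hm2 : Measurable fun (Z : ℕ × Fin m → BranchVec × (ℕ → Fin m)) i => Z (k + 1, i) :=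
    measurable_pi_lambda _ fun i => measurable_pi_apply _
  rw [(indepFun_iff_map_prod_eq_prod_map_map hm.aemeasurable hm2.aemeasurable).1 h2,
    Measure.map_infinitePi_infinitePi_of_inj (P := fun _ : ℕ × Fin m => inputLaw m ν)
      (f := fun i : Fin m => (k + 1, i)) (by intro a b h; simpa using h),
    Measure.infinitePi_eq_pi]

lemma lintegral_pi_smoothing_empirical [NeZero m] (ν : Measure BranchVec) [IsProbabilityMeasure ν]
    (x : Fin m → ℝ) {g : (Fin m → ℝ) → ℝ≥0∞} (hg : Measurable g) :
    ∫⁻ y, g y ∂(Measure.pi fun _ => smoothing ν (empirical x)) =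
      ∫⁻ y, g (fun i => poolStep x (y i)) ∂(Measure.pi fun _ : Fin m => inputLaw m ν) := by
  have hx : Measurable (poolStep x) := measurable_poolStep.comp measurable_prodMk_left
  have hx' : Measurable fun (y : Fin m → BranchVec × (ℕ → Fin m)) i => poolStep x (y i) :=
    measurable_pi_lambda _ fun i => hx.comp (measurable_pi_apply i)
  simp_rw [← map_poolStep]
  rw [← Measure.pi_map_pi (f := fun _ => poolStep x) fun _ => hx.aemeasurable,
    lintegral_map hg hx']

/-- The Markov property: conditionally on the pool of level `k`, the next pool is an i.i.d. sample
from the smoothed empirical measure. -/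
lemma lintegral_inputPool_succ [NeZero m] (ν : Measure BranchVec) [IsProbabilityMeasure ν]
    (k : ℕ) {g : (Fin m → ℝ) → ℝ≥0∞} (hg : Measurable g) :
    ∫⁻ Z, g (inputPool (k + 1) Z) ∂(Measure.infinitePi fun _ : ℕ × Fin m => inputLaw m ν) =
      ∫⁻ Z, ∫⁻ y, g y ∂(Measure.pi fun _ => smoothing ν (empirical (inputPool k Z)))
        ∂(Measure.infinitePi fun _ : ℕ × Fin m => inputLaw m ν) := by
  have hm := measurable_inputPool (m := m) k
  have hm2 : Measurable fun (Z : ℕ × Fin m → BranchVec × (ℕ → Fin m)) i => Z (k + 1, i) :=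
    measurable_pi_lambda _ fun i => measurable_pi_apply _
  have hs : Measurable fun p : (Fin m → ℝ) × (Fin m → BranchVec × (ℕ → Fin m)) =>
      g fun i => poolStep p.1 (p.2 i) :=
    hg.comp (measurable_pi_lambda _ fun i => measurable_poolStep.comp
      (measurable_fst.prodMk ((measurable_pi_apply i).comp measurable_snd)))
  have h1 := lintegral_map (μ := Measure.infinitePi fun _ : ℕ × Fin m => inputLaw m ν) hs
    (hm.prodMk hm2)
  have h2 := lintegral_map (μ := Measure.infinitePi fun _ : ℕ × Fin m => inputLaw m ν)
    (hs.lintegral_prod_right' (ν := Measure.pi fun _ : Fin m => inputLaw m ν)) hm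
  rw [infinitePi_map_inputPool_prod, lintegral_prod _ hs.aemeasurable, h2] at h1
  simp_rw [lintegral_pi_smoothing_empirical ν _ hg, inputPool_succ]
  exact h1.symm

lemma lintegral_inputPool_zero [NeZero m] (ν : Measure BranchVec) [IsProbabilityMeasure ν]
    {g : (Fin m → ℝ) → ℝ≥0∞} (hg : Measurable g) :
    ∫⁻ Z, g (inputPool 0 Z) ∂(Measure.infinitePi fun _ : ℕ × Fin m => inputLaw m ν) =
      ∫⁻ y, g y ∂(Measure.pi fun _ => ν.map BranchVec.Q) := by
  have hQ : Measurable fun y : BranchVec × (ℕ → Fin m) => BranchVec.Q y.1 := by fun_prop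
  have h1 : ν.map BranchVec.Q = (inputLaw m ν).map fun y => BranchVec.Q y.1 := by
    conv_lhs => rw [← (measurePreserving_fst (μ := ν)
      (ν := Measure.infinitePi fun _ : ℕ => uniformOn (Set.univ : Set (Fin m)))).map_eq]
    rw [Measure.map_map (by fun_prop) (by fun_prop)]
    rfl
  rw [h1, ← Measure.pi_map_pi (μ := fun _ : Fin m => inputLaw m ν)
      (f := fun _ y => BranchVec.Q y.1) fun _ => hQ.aemeasurable,
    ← Measure.infinitePi_eq_pi,
    ← Measure.map_infinitePi_infinitePi_of_inj (P := fun _ : ℕ × Fin m => inputLaw m ν)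
      (f := fun i : Fin m => (0, i)) (by intro a b h; simpa using h),
    lintegral_map hg (by fun_prop), lintegral_map (by fun_prop) (by fun_prop)]
  rfl

lemma IsBootstrapInput.map_input [NeZero m] {Ω : Type*} [MeasurableSpace Ω] {P : Measure Ω}
    {ν : Measure BranchVec} [IsProbabilityMeasure ν] {B : ℕ → Fin m → Ω → BranchVec}
    {S : ℕ → Fin m → ℕ → Ω → Fin m} (h : IsBootstrapInput P ν B S) :
    P.map (fun ω (p : ℕ × Fin m) => (B p.1 p.2 ω, fun r => S p.1 p.2 r ω)) =
      Measure.infinitePi fun _ => inputLaw m ν := by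
  have := h.indep_B.isProbabilityMeasure
  have hmB : Measurable fun ω (p : ℕ × Fin m) => B p.1 p.2 ω :=
    measurable_pi_lambda _ fun p => h.measurable_B _ _
  have hmS : Measurable fun ω (p : ℕ × Fin m × ℕ) => S p.1 p.2.1 p.2.2 ω :=
    measurable_pi_lambda _ fun p => h.measurable_S _ _ _
  have hB := h.indep_B.map_fun_eq_infinitePi_map fun p => h.measurable_B _ _
  have hS := h.indep_S.map_fun_eq_infinitePi_map fun p => h.measurable_S _ _ _
  simp_rw [h.law_B] at hB
  simp_rw [h.law_S] at hS
  have hBS := (indepFun_iff_map_prod_eq_prod_map_map hmB.aemeasurable hmS.aemeasurable).1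
    h.indep_B_S
  -- Grouping the resampling positions by pool member gives both inputs the index set `ℕ × Fin m`,
  -- so that they can be paired coordinatewise.
  have hcurry : (Measure.infinitePi fun _ : ℕ × Fin m => Measure.infinitePi fun _ : ℕ =>
      uniformOn (Set.univ : Set (Fin m))) =
      (Measure.infinitePi fun _ : ℕ × Fin m × ℕ => uniformOn (Set.univ : Set (Fin m))).map
        fun s p r => s (p.1, p.2, r) := by
    rw [← Measure.infinitePi_map_curry (fun (_ : ℕ × Fin m) (_ : ℕ) =>
        uniformOn (Set.univ : Set (Fin m))),
      ← Measure.map_infinitePi_infinitePi_of_inj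
        (P := fun _ : ℕ × Fin m × ℕ => uniformOn (Set.univ : Set (Fin m)))
        (f := fun p : (ℕ × Fin m) × ℕ => (p.1.1, p.1.2, p.2)),
      Measure.map_map (by fun_prop) (by fun_prop)]
    · rfl
    · rintro ⟨⟨a, b⟩, c⟩ ⟨⟨a', b'⟩, c'⟩ h
      simp_all
  unfold inputLaw
  rw [← infinitePi_prod_infinitePi_map_zip, hcurry, ← hS, ← hB]
  rw [prod_map_right _ _ (by fun_prop), ← hBS,
    Measure.map_map (by fun_prop) (hmB.prodMk hmS), Measure.map_map]
  · rfl
  · fun_prop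
  · exact Measurable.comp (by fun_prop) (hmB.prodMk hmS)

end Pool

/-! ### Sampling error of an i.i.d. sample -/

lemma integral_abs_sum_sub_le {m : ℕ} [NeZero m] (μ : Measure ℝ) [IsProbabilityMeasure μ]
    {f : ℝ → ℝ} (hf : Measurable f) (hf1 : ∀ x, |f x| ≤ 1) :
    ∫ y, |(m : ℝ)⁻¹ * ∑ i, f (y i) - ∫ x, f x ∂μ| ∂(Measure.pi fun _ : Fin m => μ) ≤ 1 / √m := by
  set M := Measure.pi fun _ : Fin m => μ
  have hm0 : (0 : ℝ) < m := by exact_mod_cast Nat.pos_of_ne_zero (NeZero.ne m)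
  have hL : MemLp f 2 μ := MemLp.of_bound hf.aestronglyMeasurable 1 (.of_forall hf1)
  set G : (Fin m → ℝ) → ℝ := ∑ i, fun y => f (y i) with hG
  have hGm : Measurable G := by rw [hG]; fun_prop
  have hGi (i : Fin m) : Integrable (fun y : Fin m → ℝ => f (y i)) M :=
    Integrable.of_bound (Measurable.aestronglyMeasurable (by fun_prop)) 1
      (.of_forall fun y => hf1 _)
  have hvar : Var[G; M] ≤ m := by
    rw [hG, variance_sum_pi fun _ => hL]
    have h1 : Var[f; μ] ≤ 1 := by
      refine (variance_le_expectation_sq hf.aestronglyMeasurable).trans ?_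
      refine (integral_mono (g := fun _ => 1) hL.integrable_sq (integrable_const _)
        fun x => ?_).trans (by simp)
      simpa using (sq_le_one_iff_abs_le_one _).2 (hf1 x)
    refine (Finset.sum_le_sum fun _ _ => h1).trans (by simp)
  have hmean : ∫ y, G y ∂M = m * ∫ x, f x ∂μ := by
    simp only [hG, Finset.sum_apply]
    rw [integral_finsetSum _ fun i _ => hGi i]
    have (i : Fin m) : ∫ y : Fin m → ℝ, f (y i) ∂M = ∫ x, f x ∂μ := by
      have hp := measurePreserving_eval (fun _ : Fin m => μ) i
      rw [← hp.map_eq, integral_map hp.measurable.aemeasurable hf.aestronglyMeasurable]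
    simp [this]
  have hX2 : MemLp (fun y => |G y - ∫ y, G y ∂M|) 2 M := by
    refine MemLp.of_bound (Measurable.aestronglyMeasurable (by fun_prop))
      (m + |∫ y, G y ∂M|) (.of_forall fun y => ?_)
    rw [Real.norm_eq_abs, abs_abs]
    refine (abs_sub _ _).trans ?_
    gcongr
    simp only [hG, Finset.sum_apply]
    refine (Finset.abs_sum_le_sum_abs _ _).trans
      ((Finset.sum_le_sum fun i _ => hf1 (y i)).trans (by simp))
  -- `(E|Y|)² ≤ E[Y²]` is nonnegativity of the variance of `|Y|`, with `Y = G - E G`.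
  have hcs : (∫ y, |G y - ∫ y, G y ∂M| ∂M) ^ 2 ≤ m := by
    have h := variance_nonneg (fun y => |G y - ∫ y, G y ∂M|) M
    rw [variance_eq_sub hX2] at h
    have h2 : ∫ y, ((fun y => |G y - ∫ y, G y ∂M|) ^ 2) y ∂M = Var[G; M] := by
      rw [variance_eq_integral hGm.aemeasurable]
      simp
    linarith
  have hle := Real.le_sqrt_of_sq_le hcs
  have heq (y : Fin m → ℝ) : |(m : ℝ)⁻¹ * ∑ i, f (y i) - ∫ x, f x ∂μ| =
      (m : ℝ)⁻¹ * |G y - ∫ y, G y ∂M| := by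
    rw [hmean, ← abs_of_pos (inv_pos.2 hm0), ← abs_mul, abs_of_pos (inv_pos.2 hm0), mul_sub,
      inv_mul_cancel_left₀ hm0.ne']
    simp [hG]
  simp_rw [heq]
  rw [integral_const_mul]
  calc (m : ℝ)⁻¹ * ∫ y, |G y - ∫ y, G y ∂M| ∂M ≤ (m : ℝ)⁻¹ * √m := by gcongr
    _ = 1 / √m := by
      rw [eq_div_iff (by positivity), mul_assoc, Real.mul_self_sqrt hm0.le,
        inv_mul_cancel₀ hm0.ne']

lemma charFun_eq_integral_cos_add_sin (μ : Measure ℝ) [IsProbabilityMeasure μ] (t : ℝ) :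
    charFun μ t = (∫ x, Real.cos (t * x) ∂μ : ℝ) + (∫ x, Real.sin (t * x) ∂μ : ℝ) * Complex.I := by
  have hc : Integrable (fun x => Real.cos (t * x)) μ :=
    Integrable.of_bound (Measurable.aestronglyMeasurable (by fun_prop)) 1
      (.of_forall fun x => Real.abs_cos_le_one _)
  have hs : Integrable (fun x => Real.sin (t * x)) μ :=
    Integrable.of_bound (Measurable.aestronglyMeasurable (by fun_prop)) 1
      (.of_forall fun x => Real.abs_sin_le_one _)
  rw [charFun_apply_real, ← integral_complex_ofReal, ← integral_complex_ofReal,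
    ← integral_mul_const, ← integral_add hc.ofReal (hs.ofReal.mul_const _)]
  refine integral_congr_ae (.of_forall fun x => ?_)
  simp [Complex.exp_mul_I]

lemma integral_empirical {m : ℕ} (x : Fin m → ℝ) {f : ℝ → ℝ} (hf : Measurable f) :
    ∫ y, f y ∂(empirical x) = (m : ℝ)⁻¹ * ∑ i, f (x i) := by
  rw [empirical, integral_map (measurable_of_countable x).aemeasurable hf.aestronglyMeasurable,
    uniformOn_univ_fin_eq_smul_count, integral_smul_measure, integral_count]
  simp

/-- The variance bound is applied separately to the cosine and sine parts; each contributes `1/√m`.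
-/
lemma lintegral_enorm_charFun_empirical_sub_le {m : ℕ} [NeZero m] (μ : Measure ℝ)
    [IsProbabilityMeasure μ] (t : ℝ) :
    ∫⁻ y, ‖charFun (empirical y) t - charFun μ t‖ₑ ∂(Measure.pi fun _ : Fin m => μ) ≤
      ENNReal.ofReal (2 / √m) := by
  have hfluct {f : ℝ → ℝ} (hf : Measurable f) (hf1 : ∀ x, |f x| ≤ 1) :
      ∫⁻ y, ‖∫ x, f x ∂(empirical y) - ∫ x, f x ∂μ‖ₑ ∂(Measure.pi fun _ : Fin m => μ) ≤
        ENNReal.ofReal (1 / √m) := by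
    have hint : Integrable (fun y : Fin m → ℝ => (m : ℝ)⁻¹ * ∑ i, f (y i) - ∫ x, f x ∂μ)
        (Measure.pi fun _ : Fin m => μ) := by
      refine Integrable.sub (Integrable.const_mul (integrable_finsetSum _ fun i _ => ?_) _)
        (integrable_const _)
      exact Integrable.of_bound (Measurable.aestronglyMeasurable (by fun_prop)) 1
        (.of_forall fun y => hf1 _)
    simp_rw [integral_empirical _ hf]
    rw [← ofReal_integral_norm_eq_lintegral_enorm hint]
    exact ENNReal.ofReal_le_ofReal (integral_abs_sum_sub_le μ hf hf1)
  have hpt (y : Fin m → ℝ) : ‖charFun (empirical y) t - charFun μ t‖ₑ ≤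
      ‖∫ x, Real.cos (t * x) ∂(empirical y) - ∫ x, Real.cos (t * x) ∂μ‖ₑ +
      ‖∫ x, Real.sin (t * x) ∂(empirical y) - ∫ x, Real.sin (t * x) ∂μ‖ₑ := by
    rw [charFun_eq_integral_cos_add_sin, charFun_eq_integral_cos_add_sin μ]
    set a := ∫ x, Real.cos (t * x) ∂(empirical y)
    set b := ∫ x, Real.cos (t * x) ∂μ
    set c := ∫ x, Real.sin (t * x) ∂(empirical y)
    set d := ∫ x, Real.sin (t * x) ∂μ
    rw [show (a : ℂ) + c * Complex.I - (b + d * Complex.I) =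
      ((a - b : ℝ) : ℂ) + ((c - d : ℝ) : ℂ) * Complex.I by push_cast; ring]
    refine (enorm_add_le _ _).trans_eq ?_
    simp only [← ofReal_norm, norm_mul, Complex.norm_I, mul_one, Complex.norm_real]
  refine (lintegral_mono hpt).trans ?_
  rw [lintegral_add_left]
  · refine (add_le_add (hfluct (by fun_prop) fun x => Real.abs_cos_le_one _)
      (hfluct (by fun_prop) fun x => Real.abs_sin_le_one _)).trans_eq ?_
    rw [← ENNReal.ofReal_add (by positivity) (by positivity)]
    congr 1
    ring
  · have hcos : Measurable fun x : ℝ => Real.cos (t * x) := by fun_prop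
    simp_rw [integral_empirical _ hcos]
    fun_prop

/-! ### Stability of the smoothing transform -/

lemma enorm_prod_le_one {ι : Type*} (s : Finset ι) (a : ι → ℂ) (ha : ∀ r, ‖a r‖ₑ ≤ 1) :
    ‖∏ r ∈ s, a r‖ₑ ≤ 1 := by
  classical
  induction s using Finset.induction_on with
  | empty => simp
  | insert r s hr ih =>
    rw [Finset.prod_insert hr, enorm_mul]
    exact mul_le_one' (ha r) ih

/-- Telescoping: factors are exchanged one at a time, the others having modulus at most `1`. -/
lemma enorm_prod_sub_prod_le {ι : Type*} (s : Finset ι) (a b : ι → ℂ) (ha : ∀ r, ‖a r‖ₑ ≤ 1)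
    (hb : ∀ r, ‖b r‖ₑ ≤ 1) : ‖∏ r ∈ s, a r - ∏ r ∈ s, b r‖ₑ ≤ ∑ r ∈ s, ‖a r - b r‖ₑ := by
  classical
  induction s using Finset.induction_on with
  | empty => simp
  | insert r s hr ih =>
    rw [Finset.prod_insert hr, Finset.prod_insert hr, Finset.sum_insert hr]
    have hB := enorm_prod_le_one s b hb
    rw [show a r * ∏ r ∈ s, a r - b r * ∏ r ∈ s, b r =
      (a r - b r) * ∏ r ∈ s, b r + a r * (∏ r ∈ s, a r - ∏ r ∈ s, b r) by ring]
    refine (enorm_add_le _ _).trans ?_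
    rw [enorm_mul, enorm_mul]
    exact add_le_add (mul_le_of_le_one_right' hB) ((mul_le_of_le_one_left' (ha r)).trans ih)

lemma enorm_charFun_le_one (μ : Measure ℝ) [IsProbabilityMeasure μ] (t : ℝ) :
    ‖charFun μ t‖ₑ ≤ 1 := by
  rw [← ofReal_norm, ← ENNReal.ofReal_one]
  exact ENNReal.ofReal_le_ofReal (norm_charFun_le_one t)

/-- The product `∏_{r ≤ N} φ_μ(t C_r)` of values of the characteristic function of `μ`. -/
noncomputable def charProd (μ : Measure ℝ) (t : ℝ) (v : BranchVec) : ℂ :=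
  ∏ r ∈ Finset.range (BranchVec.N v), charFun μ (t * BranchVec.C v r)

lemma measurable_charProd (μ : Measure ℝ) [IsProbabilityMeasure μ] (t : ℝ) :
    Measurable (charProd μ t) :=
  measurable_range_comp
    (F := fun n v => ∏ r ∈ Finset.range n, charFun μ (t * BranchVec.C v r))
    (fun n => by fun_prop) BranchVec.measurable_N

lemma measurable_charProd_empirical {m : ℕ} (t : ℝ) :
    Measurable fun p : BranchVec × (Fin m → ℝ) => charProd (empirical p.2) t p.1 := by
  unfold charProd
  refine measurable_range_comp (F := fun n (p : BranchVec × (Fin m → ℝ)) =>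
    ∏ r ∈ Finset.range n, charFun (empirical p.2) (t * BranchVec.C p.1 r))
    (N := fun p => BranchVec.N p.1) (fun n => ?_) (by fun_prop)
  simp_rw [charFun_empirical]
  fun_prop

lemma enorm_charProd_le_one (μ : Measure ℝ) [IsProbabilityMeasure μ] (t : ℝ) (v : BranchVec) :
    ‖charProd μ t v‖ₑ ≤ 1 :=
  enorm_prod_le_one _ _ fun _ => enorm_charFun_le_one μ _

lemma integrable_cexp_mul_charProd (ν : Measure BranchVec) [IsProbabilityMeasure ν] (μ : Measure ℝ)
    [IsProbabilityMeasure μ] (t : ℝ) :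
    Integrable (fun v => Complex.exp ((t * BranchVec.Q v : ℝ) * Complex.I) * charProd μ t v) ν := by
  have h := measurable_charProd μ t
  refine Integrable.of_bound (Measurable.aestronglyMeasurable (by fun_prop)) 1
    (.of_forall fun v => ?_)
  rw [norm_mul]
  refine mul_le_one₀ (norm_cexp_ofReal_mul_I_le _) (norm_nonneg _) ?_
  have h1 := enorm_charProd_le_one μ t v
  rwa [← ofReal_norm, ENNReal.ofReal_le_one] at h1

lemma enorm_charFun_smoothing_sub_le (ν : Measure BranchVec) [IsProbabilityMeasure ν]
    (μ μ' : Measure ℝ) [IsProbabilityMeasure μ] [IsProbabilityMeasure μ'] (t : ℝ) :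
    ‖charFun (smoothing ν μ) t - charFun (smoothing ν μ') t‖ₑ ≤
      ∫⁻ v, ‖charProd μ t v - charProd μ' t v‖ₑ ∂ν := by
  rw [charFun_smoothing, charFun_smoothing]
  have h := integral_sub (integrable_cexp_mul_charProd ν μ t) (integrable_cexp_mul_charProd ν μ' t)
  unfold charProd at h ⊢
  rw [← h]
  refine (enorm_integral_le_lintegral_enorm _).trans (lintegral_mono fun v => ?_)
  rw [← mul_sub, enorm_mul]
  refine mul_le_of_le_one_left' ?_
  rw [← ofReal_norm, ENNReal.ofReal_le_one]
  exact norm_cexp_ofReal_mul_I_le _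

/-! ### Convergence of the characteristic functions of the pools -/

lemma tendsto_ofReal_two_div_sqrt :
    Tendsto (fun m : ℕ => ENNReal.ofReal (2 / √((m + 1 : ℕ) : ℝ))) atTop (𝓝 0) := by
  rw [← ENNReal.ofReal_zero]
  refine ENNReal.tendsto_ofReal (Tendsto.div_atTop tendsto_const_nhds ?_)
  exact Real.tendsto_sqrt_atTop.comp
    (tendsto_natCast_atTop_atTop.comp (tendsto_add_atTop_nat 1))

lemma measurable_enorm_charFun_empirical_sub {m : ℕ} (t : ℝ) (z : ℂ) :
    Measurable fun y : Fin m → ℝ => ‖charFun (empirical y) t - z‖ₑ := by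
  simp_rw [charFun_empirical]
  fun_prop

lemma measurable_enorm_charProd_inputPool_sub (ν : Measure BranchVec) [IsProbabilityMeasure ν]
    (k : ℕ) (t : ℝ) (m : ℕ) :
    Measurable fun p : BranchVec × (ℕ × Fin (m + 1) → BranchVec × (ℕ → Fin (m + 1))) =>
      ‖charProd (empirical (inputPool k p.2)) t p.1 - charProd (treeLaw ν k) t p.1‖ₑ := by
  have h1 := (measurable_charProd_empirical (m := m + 1) t).comp
    (measurable_fst.prodMk ((measurable_inputPool k).comp measurable_snd))
  exact (h1.sub ((measurable_charProd (treeLaw ν k) t).comp measurable_fst)).enorm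

/-- For a fixed vector `v` only the finitely many frequencies `t * C_r` enter, which is why the
induction hypothesis is required at every frequency. Integration over `v` is then dominated by the
constant `2`. -/
lemma tendsto_lintegral_charProd_sub (ν : Measure BranchVec) [IsProbabilityMeasure ν] (k : ℕ)
    (t : ℝ) (ih : ∀ t, Tendsto (fun m : ℕ => ∫⁻ Z, ‖charFun (empirical (inputPool k Z)) t -
      charFun (treeLaw ν k) t‖ₑ ∂(Measure.infinitePi fun _ : ℕ × Fin (m + 1) =>
        inputLaw (m + 1) ν)) atTop (𝓝 0)) :
    Tendsto (fun m : ℕ => ∫⁻ v, ∫⁻ Z, ‖charProd (empirical (inputPool k Z)) t v -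
      charProd (treeLaw ν k) t v‖ₑ ∂(Measure.infinitePi fun _ : ℕ × Fin (m + 1) =>
        inputLaw (m + 1) ν) ∂ν) atTop (𝓝 0) := by
  have hmeas := measurable_enorm_charProd_inputPool_sub ν k t
  rw [← lintegral_zero (μ := ν)]
  refine tendsto_lintegral_of_dominated_convergence (fun _ => 2)
    (fun m => (hmeas m).lintegral_prod_right') (fun m => .of_forall fun v => ?_) (by simp)
    (.of_forall fun v => ?_)
  · refine (lintegral_mono (g := fun _ => 2) fun Z => ?_).trans (by simp)
    refine enorm_sub_le.trans ((add_le_add (enorm_charProd_le_one _ _ _)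
      (enorm_charProd_le_one _ _ _)).trans_eq one_add_one_eq_two)
  · have hsum : Tendsto (fun m : ℕ => ∑ r ∈ Finset.range (BranchVec.N v),
        ∫⁻ Z, ‖charFun (empirical (inputPool k Z)) (t * BranchVec.C v r) -
          charFun (treeLaw ν k) (t * BranchVec.C v r)‖ₑ ∂(Measure.infinitePi
            fun _ : ℕ × Fin (m + 1) => inputLaw (m + 1) ν)) atTop (𝓝 0) := by
      simpa using tendsto_finsetSum (Finset.range (BranchVec.N v))
        fun r _ => ih (t * BranchVec.C v r)
    refine tendsto_of_tendsto_of_tendsto_of_le_of_le tendsto_const_nhds hsum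
      (fun _ => zero_le) fun m => ?_
    dsimp only
    have hm (r : ℕ) : Measurable fun Z : ℕ × Fin (m + 1) → BranchVec × (ℕ → Fin (m + 1)) =>
        ‖charFun (empirical (inputPool k Z)) (t * BranchVec.C v r) -
          charFun (treeLaw ν k) (t * BranchVec.C v r)‖ₑ :=
      (measurable_enorm_charFun_empirical_sub _ _).comp (measurable_inputPool k)
    rw [← lintegral_finsetSum _ fun r _ => hm r]
    exact lintegral_mono fun Z => enorm_prod_sub_prod_le _ _ _
      (fun r => enorm_charFun_le_one _ _) (fun r => enorm_charFun_le_one _ _)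

lemma tendsto_lintegral_charFun_inputPool_sub (ν : Measure BranchVec) [IsProbabilityMeasure ν]
    (k : ℕ) (t : ℝ) :
    Tendsto (fun m : ℕ => ∫⁻ Z, ‖charFun (empirical (inputPool k Z)) t -
      charFun (treeLaw ν k) t‖ₑ ∂(Measure.infinitePi fun _ : ℕ × Fin (m + 1) =>
        inputLaw (m + 1) ν)) atTop (𝓝 0) := by
  induction k generalizing t with
  | zero =>
    refine tendsto_of_tendsto_of_tendsto_of_le_of_le tendsto_const_nhds
      tendsto_ofReal_two_div_sqrt (fun _ => zero_le) fun m => ?_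
    dsimp only
    rw [lintegral_inputPool_zero ν (measurable_enorm_charFun_empirical_sub _ _)]
    have : IsProbabilityMeasure (ν.map BranchVec.Q) :=
      inferInstanceAs (IsProbabilityMeasure (treeLaw ν 0))
    exact lintegral_enorm_charFun_empirical_sub_le _ t
  | succ k ih =>
    have hlim := tendsto_ofReal_two_div_sqrt.add (tendsto_lintegral_charProd_sub ν k t ih)
    rw [zero_add] at hlim
    refine tendsto_of_tendsto_of_tendsto_of_le_of_le tendsto_const_nhds hlim
      (fun _ => zero_le) fun m => ?_
    dsimp only
    -- After the swap, the bound for the inherited error integrates over the pool and the branching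
    -- vector in the order obtained from `hle`.
    rw [lintegral_inputPool_succ ν k (measurable_enorm_charFun_empirical_sub _ _),
      lintegral_lintegral_swap
        (measurable_enorm_charProd_inputPool_sub ν k t m).aemeasurable]
    have hle (x : Fin (m + 1) → ℝ) : ∫⁻ y, ‖charFun (empirical y) t -
        charFun (treeLaw ν (k + 1)) t‖ₑ ∂(Measure.pi fun _ : Fin (m + 1) =>
          smoothing ν (empirical x)) ≤ ENNReal.ofReal (2 / √((m + 1 : ℕ) : ℝ)) +
        ∫⁻ v, ‖charProd (empirical x) t v - charProd (treeLaw ν k) t v‖ₑ ∂ν := by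
      -- The intermediate term is the conditional law of a new member given the pool `x`: it
      -- separates the fresh sampling error from the error inherited from `x`.
      have htri (y : Fin (m + 1) → ℝ) : ‖charFun (empirical y) t -
          charFun (treeLaw ν (k + 1)) t‖ₑ ≤
          ‖charFun (empirical y) t - charFun (smoothing ν (empirical x)) t‖ₑ +
          ‖charFun (smoothing ν (empirical x)) t - charFun (treeLaw ν (k + 1)) t‖ₑ := by
        rw [← sub_add_sub_cancel (charFun (empirical y) t)
          (charFun (smoothing ν (empirical x)) t) (charFun (treeLaw ν (k + 1)) t)]
        exact enorm_add_le _ _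
      refine (lintegral_mono htri).trans ?_
      rw [lintegral_add_right _ measurable_const, lintegral_const, measure_univ, mul_one]
      exact add_le_add (lintegral_enorm_charFun_empirical_sub_le _ t)
        (enorm_charFun_smoothing_sub_le ν _ _ t)
    refine (lintegral_mono fun Z => hle (inputPool k Z)).trans_eq ?_
    rw [lintegral_add_left measurable_const, lintegral_const, measure_univ, mul_one]

/-! ### Moments of the pools, uniformly in the pool size -/

lemma lintegral_lintegral_empirical_pi {m : ℕ} [NeZero m] (μ : Measure ℝ) [IsProbabilityMeasure μ]
    {f : ℝ → ℝ≥0∞} (hf : Measurable f) :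
    ∫⁻ y, ∫⁻ x, f x ∂(empirical y) ∂(Measure.pi fun _ : Fin m => μ) = ∫⁻ x, f x ∂μ := by
  simp_rw [lintegral_empirical _ hf]
  rw [lintegral_const_mul _ (by fun_prop), lintegral_finsetSum _ (by fun_prop)]
  have (i : Fin m) : ∫⁻ y : Fin m → ℝ, f (y i) ∂(Measure.pi fun _ : Fin m => μ)
      = ∫⁻ x, f x ∂μ := (measurePreserving_eval (fun _ : Fin m => μ) i).lintegral_comp hf
  simp only [this, Finset.sum_const, Finset.card_univ, Fintype.card_fin, nsmul_eq_mul]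
  rw [← mul_assoc, ENNReal.inv_mul_cancel (by exact_mod_cast NeZero.ne m)
    (ENNReal.natCast_ne_top m), one_mul]

lemma measurable_lintegral_empirical {m : ℕ} {f : ℝ → ℝ≥0∞} (hf : Measurable f) :
    Measurable fun y : Fin m → ℝ => ∫⁻ x, f x ∂(empirical y) := by
  simp_rw [lintegral_empirical _ hf]
  fun_prop

/-- The moments of order `β` of the pools are bounded uniformly in the pool size. -/
lemma exists_moment_bound (ν : Measure BranchVec) [IsProbabilityMeasure ν] {β : ℝ} (hβ : 1 ≤ β)
    (hQ : ∫⁻ v, ‖BranchVec.Q v‖ₑ ^ β ∂ν < ∞)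
    (hC : ∫⁻ v, (∑ r ∈ Finset.range (BranchVec.N v), ‖BranchVec.C v r‖ₑ) ^ β ∂ν < ∞) (k : ℕ) :
    ∃ K : ℝ≥0∞, K < ∞ ∧ ∫⁻ x, ‖x‖ₑ ^ β ∂(treeLaw ν k) ≤ K ∧ ∀ m : ℕ,
      ∫⁻ Z, ∫⁻ x, ‖x‖ₑ ^ β ∂(empirical (inputPool k Z)) ∂(Measure.infinitePi
        fun _ : ℕ × Fin (m + 1) => inputLaw (m + 1) ν) ≤ K := by
  have hf : Measurable fun x : ℝ => ‖x‖ₑ ^ β := by fun_prop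
  induction k with
  | zero =>
    have h0 : ∫⁻ x, ‖x‖ₑ ^ β ∂(treeLaw ν 0) = ∫⁻ v, ‖BranchVec.Q v‖ₑ ^ β ∂ν := by
      rw [treeLaw, lintegral_map hf BranchVec.measurable_Q]
    have : IsProbabilityMeasure (ν.map BranchVec.Q) :=
      inferInstanceAs (IsProbabilityMeasure (treeLaw ν 0))
    refine ⟨_, hQ, h0.le, fun m => ?_⟩
    rw [lintegral_inputPool_zero ν (measurable_lintegral_empirical hf),
      lintegral_lintegral_empirical_pi _ hf, ← h0]
    rfl
  | succ k ih =>
    obtain ⟨K, hK, hT, hP⟩ := ih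
    -- The moment bound for `smoothing` is affine and increasing in the moment of its input, and its
    -- coefficients do not involve `m`. The same new constant thus serves the tree law and, after
    -- taking expectations, all pools.
    refine ⟨2 ^ (β - 1) * ((∫⁻ v, (∑ r ∈ Finset.range (BranchVec.N v), ‖BranchVec.C v r‖ₑ) ^ β ∂ν)
      * K + ∫⁻ v, ‖BranchVec.Q v‖ₑ ^ β ∂ν), ?_, ?_, fun m => ?_⟩
    · exact ENNReal.mul_lt_top (ENNReal.rpow_lt_top_of_nonneg (by linarith) (by simp))
        (ENNReal.add_lt_top.2 ⟨ENNReal.mul_lt_top hC hK, hQ⟩)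
    · refine (lintegral_rpow_smoothing_le ν _ hβ).trans ?_
      gcongr
    · rw [lintegral_inputPool_succ ν k (measurable_lintegral_empirical hf)]
      simp_rw [lintegral_lintegral_empirical_pi _ hf]
      have hm : Measurable fun Z : ℕ × Fin (m + 1) → BranchVec × (ℕ → Fin (m + 1)) =>
          ∫⁻ x, ‖x‖ₑ ^ β ∂(empirical (inputPool k Z)) :=
        (measurable_lintegral_empirical hf).comp (measurable_inputPool k)
      refine (lintegral_mono fun Z => lintegral_rpow_smoothing_le ν _ hβ).trans ?_
      rw [lintegral_const_mul _ ((hm.const_mul _).add_const _),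
        lintegral_add_right _ measurable_const, lintegral_const_mul _ hm, lintegral_const,
        measure_univ, mul_one]
      gcongr
      exact hP m

/-! ### Random measures: from characteristic functions to bounded continuous functions -/

open scoped BoundedContinuousFunction

/-- The empirical measure as a kernel. -/
noncomputable def empiricalKernel (m : ℕ) : Kernel (Fin m → ℝ) ℝ where
  toFun := empirical
  measurable' := by
    refine Measure.measurable_of_measurable_coe _ fun s hs => ?_
    have h (x : Fin m → ℝ) : empirical x s = (m : ℝ≥0∞)⁻¹ * ∑ i, s.indicator 1 (x i) := by
      rw [← lintegral_indicator_one hs, lintegral_empirical x (measurable_one.indicator hs)]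
    simp_rw [h]
    have : Measurable (s.indicator (1 : ℝ → ℝ≥0∞)) := measurable_one.indicator hs
    fun_prop

instance (m : ℕ) [NeZero m] : IsMarkovKernel (empiricalKernel m) :=
  ⟨fun x => inferInstanceAs (IsProbabilityMeasure (empirical x))⟩

lemma integral_abs_eq_setIntegral_sub {Ω : Type*} [MeasurableSpace Ω] {P : Measure Ω}
    {g : Ω → ℝ} (hg : Measurable g) (hgi : Integrable g P) :
    ∫ ω, |g ω| ∂P = ∫ ω in {ω | 0 ≤ g ω}, g ω ∂P - ∫ ω in {ω | 0 ≤ g ω}ᶜ, g ω ∂P := by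
  have hA : MeasurableSet {ω | 0 ≤ g ω} := measurableSet_le measurable_const hg
  rw [← integral_add_compl hA hgi.abs, sub_eq_add_neg, ← integral_neg]
  congr 1
  · exact setIntegral_congr_fun hA fun ω hω => abs_of_nonneg hω
  · refine setIntegral_congr_fun hA.compl fun ω hω => abs_of_nonpos ?_
    exact (not_le.1 (Set.mem_compl_iff _ _ |>.1 hω)).le

section Mixture

variable {Ω : Type*} [MeasurableSpace Ω] {P : Measure Ω} [IsProbabilityMeasure P]
  {μ : Measure ℝ} [IsProbabilityMeasure μ]

/-- The mixture over `P` of the kernel `η` on the event `A` and of `μ` outside of `A`. -/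
noncomputable def mixture (P : Measure Ω) (η : Kernel Ω ℝ) (μ : Measure ℝ) {A : Set Ω}
    (hA : MeasurableSet A) : Measure ℝ := by
  classical
  exact (Kernel.piecewise hA η (Kernel.const Ω μ) ∘ₖ Kernel.const Unit P) ()

instance (η : Kernel Ω ℝ) [IsMarkovKernel η] {A : Set Ω} (hA : MeasurableSet A) :
    IsProbabilityMeasure (mixture P η μ hA) := by
  classical
  unfold mixture
  infer_instance

/-- Outside `A` the mixture agrees with `μ`, so only the deviation on `A` survives. The target space
`E` allows complex exponentials as well as real test functions. -/
lemma integral_mixture_sub {E : Type*} [NormedAddCommGroup E] [NormedSpace ℝ E]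
    [CompleteSpace E] [SecondCountableTopology E] [MeasurableSpace E] [BorelSpace E]
    (η : Kernel Ω ℝ) [IsMarkovKernel η] {A : Set Ω}
    (hA : MeasurableSet A) {f : ℝ → E} (hf : Measurable f) {c : ℝ} (hc : ∀ x, ‖f x‖ ≤ c) :
    ∫ x, f x ∂(mixture P η μ hA) - ∫ x, f x ∂μ =
      ∫ ω in A, (∫ x, f x ∂(η ω) - ∫ x, f x ∂μ) ∂P := by
  classical
  have hint : Integrable f (mixture P η μ hA) :=
    Integrable.of_bound hf.aestronglyMeasurable c (.of_forall hc)
  have hmeas : StronglyMeasurable fun ω => ∫ x, f x ∂(η ω) :=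
    (hf.stronglyMeasurable.comp_measurable measurable_snd).integral_kernel_prod_right'
  have hint2 : Integrable (fun ω => ∫ x, f x ∂(η ω)) P := by
    refine Integrable.of_bound hmeas.aestronglyMeasurable c (.of_forall fun ω => ?_)
    simpa using norm_integral_le_of_norm_le_const (μ := η ω) (.of_forall hc)
  rw [mixture, Kernel.integral_comp hint, Kernel.const_apply, ← integral_indicator hA]
  have h1 (ω : Ω) : ∫ y, f y ∂((Kernel.piecewise hA η (Kernel.const Ω μ)) ω) =
      A.indicator (fun ω => ∫ x, f x ∂(η ω) - ∫ x, f x ∂μ) ω + ∫ x, f x ∂μ := by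
    by_cases h : ω ∈ A <;> simp [Kernel.piecewise_apply, h]
  simp_rw [h1]
  have hint3 : Integrable (fun ω => ∫ x, f x ∂(η ω) - ∫ x, f x ∂μ) P :=
    hint2.sub (integrable_const _)
  rw [integral_add (hint3.indicator hA) (integrable_const _)]
  simp

/-- The mixtures are deterministic, and their characteristic functions differ from that of `μ` by at
most the `L¹` error in `hchar`, whatever the events `A m`. Lévy's continuity theorem then gives weak
convergence. -/
lemma tendsto_setIntegral_of_tendsto_charFun {η : ℕ → Kernel Ω ℝ} [∀ m, IsMarkovKernel (η m)]
    (hchar : ∀ t, Tendsto (fun m => ∫⁻ ω, ‖charFun (η m ω) t - charFun μ t‖ₑ ∂P) atTop (𝓝 0))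
    {A : ℕ → Set Ω} (hA : ∀ m, MeasurableSet (A m)) (f : ℝ →ᵇ ℝ) :
    Tendsto (fun m => ∫ ω in A m, (∫ x, f x ∂(η m ω) - ∫ x, f x ∂μ) ∂P) atTop (𝓝 0) := by
  let lam : ℕ → ProbabilityMeasure ℝ := fun m => ⟨mixture P (η m) μ (hA m), inferInstance⟩
  let μ₀ : ProbabilityMeasure ℝ := ⟨μ, inferInstance⟩
  have hlam : Tendsto lam atTop (𝓝 μ₀) := by
    refine ProbabilityMeasure.tendsto_iff_tendsto_charFun.2 fun t => ?_
    rw [tendsto_iff_edist_tendsto_0]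
    refine tendsto_of_tendsto_of_tendsto_of_le_of_le tendsto_const_nhds (hchar t)
      (fun _ => zero_le) fun m => ?_
    dsimp only
    have h := integral_mixture_sub (P := P) (μ := μ) (η m) (hA m)
      (f := fun x : ℝ => Complex.exp (t * x * Complex.I)) (by fun_prop) (c := 1)
      (fun x => by exact_mod_cast norm_cexp_ofReal_mul_I_le (t * x))
    simp_rw [← charFun_apply_real] at h
    change edist (charFun (mixture P (η m) μ (hA m)) t) (charFun μ t) ≤ _
    rw [edist_eq_enorm_sub, h]
    exact (enorm_integral_le_lintegral_enorm _).trans (setLIntegral_le_lintegral _ _)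
  have h := (ProbabilityMeasure.tendsto_iff_forall_integral_tendsto.1 hlam f).sub_const
    (∫ x, f x ∂μ)
  rw [show ∫ x, f x ∂(μ₀ : Measure ℝ) = ∫ x, f x ∂μ from rfl, sub_self] at h
  refine h.congr fun m => ?_
  exact integral_mixture_sub (P := P) (μ := μ) (η m) (hA m) f.continuous.measurable
    f.norm_coe_le_norm

lemma tendsto_lintegral_of_tendsto_charFun {η : ℕ → Kernel Ω ℝ} [∀ m, IsMarkovKernel (η m)]
    (hchar : ∀ t, Tendsto (fun m => ∫⁻ ω, ‖charFun (η m ω) t - charFun μ t‖ₑ ∂P) atTop (𝓝 0))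
    (f : ℝ →ᵇ ℝ) :
    Tendsto (fun m => ∫⁻ ω, ‖∫ x, f x ∂(η m ω) - ∫ x, f x ∂μ‖ₑ ∂P) atTop (𝓝 0) := by
  set g : ℕ → Ω → ℝ := fun m ω => ∫ x, f x ∂(η m ω) - ∫ x, f x ∂μ with hgdef
  have hg (m : ℕ) : Measurable (g m) :=
    (StronglyMeasurable.measurable (f.continuous.measurable.stronglyMeasurable.comp_measurable
      measurable_snd).integral_kernel_prod_right').sub_const _
  have hgi (m : ℕ) : Integrable (g m) P := by
    refine Integrable.of_bound (hg m).aestronglyMeasurable (‖f‖ + ‖∫ x, f x ∂μ‖)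
      (.of_forall fun ω => (norm_sub_le _ _).trans ?_)
    gcongr
    simpa using norm_integral_le_of_norm_le_const (μ := η m ω) (.of_forall f.norm_coe_le_norm)
  have hA (m : ℕ) : MeasurableSet {ω | 0 ≤ g m ω} := measurableSet_le measurable_const (hg m)
  -- The events may vary with `m`, so the set where the deviation is nonnegative and its complement
  -- can be used; the difference of the two integrals is the `L¹` norm.
  have h := (tendsto_setIntegral_of_tendsto_charFun hchar hA f).sub
    (tendsto_setIntegral_of_tendsto_charFun hchar (fun m => (hA m).compl) f)
  rw [sub_zero] at h
  have h2 := ENNReal.tendsto_ofReal h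
  rw [ENNReal.ofReal_zero] at h2
  refine h2.congr fun m => ?_
  rw [← integral_abs_eq_setIntegral_sub (hg m) (hgi m)]
  exact ofReal_integral_norm_eq_lintegral_enorm (hgi m)

end Mixture

/-! ### Truncation and functions of linear growth -/

/-- The function `h` truncated to the interval `[-M, M]`. -/
noncomputable def clip (h : ℝ → ℝ) (hcont : Continuous h) (M : ℝ) (hM : 0 ≤ M) : ℝ →ᵇ ℝ :=
  BoundedContinuousFunction.ofNormedAddCommGroup (fun x => max (-M) (min (h x) M)) (by fun_prop) M
    fun x => abs_le.2 ⟨le_max_left _ _, max_le (by linarith) (min_le_right _ _)⟩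

/-- There is no error when `|y| ≤ M`; otherwise it is at most `|y| = |y|^(1-β) |y|^β`, and `1 - β <
0`. -/
lemma abs_sub_clip_le (y : ℝ) {M β : ℝ} (hM : 0 < M) (hβ : 1 < β) :
    |y - max (-M) (min y M)| ≤ M ^ (1 - β) * |y| ^ β := by
  by_cases h : |y| ≤ M
  · obtain ⟨h1, h2⟩ := abs_le.1 h
    rw [min_eq_left h2, max_eq_right h1, sub_self, abs_zero]
    positivity
  · push Not at h
    have hy : 0 < |y| := hM.trans h
    calc |y - max (-M) (min y M)| ≤ |y| := by
          rcases lt_abs.1 h with h1 | h1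
          · rw [min_eq_right h1.le, max_eq_right (by linarith), abs_of_pos (by linarith),
              abs_of_pos (by linarith)]
            linarith
          · rw [min_eq_left (by linarith), max_eq_left (by linarith), abs_of_neg (by linarith),
              abs_of_neg (by linarith)]
            linarith
      _ = |y| ^ (1 - β) * |y| ^ β := by
          rw [← Real.rpow_add hy, sub_add_cancel, Real.rpow_one]
      _ ≤ M ^ (1 - β) * |y| ^ β := by
          gcongr 1
          exact Real.rpow_le_rpow_of_nonpos hM h.le (by linarith)

lemma enorm_rpow_le_of_growth {h : ℝ → ℝ} {C : ℝ} (hC : 0 < C)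
    (hgrowth : ∀ x, |h x| ≤ C * (1 + |x|)) {β : ℝ} (hβ : 1 ≤ β) (x : ℝ) :
    ‖h x‖ₑ ^ β ≤ ENNReal.ofReal C ^ β * 2 ^ (β - 1) * (1 + ‖x‖ₑ ^ β) := by
  have hβ0 : 0 ≤ β := by linarith
  have h1 : ‖h x‖ₑ ≤ ENNReal.ofReal C * (1 + ‖x‖ₑ) := by
    rw [← ofReal_norm, ← ofReal_norm, ← ENNReal.ofReal_one,
      ← ENNReal.ofReal_add zero_le_one (norm_nonneg _), ← ENNReal.ofReal_mul hC.le]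
    exact ENNReal.ofReal_le_ofReal (hgrowth x)
  calc ‖h x‖ₑ ^ β ≤ (ENNReal.ofReal C * (1 + ‖x‖ₑ)) ^ β := ENNReal.rpow_le_rpow h1 hβ0
    _ = ENNReal.ofReal C ^ β * (1 + ‖x‖ₑ) ^ β := ENNReal.mul_rpow_of_nonneg _ _ hβ0
    _ ≤ ENNReal.ofReal C ^ β * (2 ^ (β - 1) * (1 ^ β + ‖x‖ₑ ^ β)) := by
        gcongr
        exact ENNReal.rpow_add_le_mul_rpow_add_rpow _ _ hβ
    _ = _ := by rw [ENNReal.one_rpow, mul_assoc]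

lemma lintegral_enorm_rpow_le_of_growth {h : ℝ → ℝ} {C : ℝ} (hC : 0 < C)
    (hgrowth : ∀ x, |h x| ≤ C * (1 + |x|)) {β : ℝ} (hβ : 1 ≤ β) (μ : Measure ℝ)
    [IsProbabilityMeasure μ] :
    ∫⁻ x, ‖h x‖ₑ ^ β ∂μ ≤ ENNReal.ofReal C ^ β * 2 ^ (β - 1) * (1 + ∫⁻ x, ‖x‖ₑ ^ β ∂μ) := by
  refine (lintegral_mono fun x => enorm_rpow_le_of_growth hC hgrowth hβ x).trans_eq ?_
  rw [lintegral_const_mul _ (by fun_prop), lintegral_add_left measurable_const, lintegral_const,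
    measure_univ, mul_one]

lemma integrable_of_growth {h : ℝ → ℝ} (hcont : Continuous h) {C : ℝ} (hC : 0 < C)
    (hgrowth : ∀ x, |h x| ≤ C * (1 + |x|)) {β : ℝ} (hβ : 1 ≤ β) {μ : Measure ℝ}
    [IsProbabilityMeasure μ] (hμ : ∫⁻ x, ‖x‖ₑ ^ β ∂μ < ∞) : Integrable h μ := by
  refine ⟨hcont.measurable.aestronglyMeasurable, ?_⟩
  have hle (x : ℝ) : ‖h x‖ₑ ≤ 1 + ‖h x‖ₑ ^ β := by
    rcases le_total ‖h x‖ₑ 1 with h1 | h1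
    · exact h1.trans le_self_add
    · refine le_add_left ?_
      simpa using ENNReal.rpow_le_rpow_of_exponent_le h1 hβ
  refine (lintegral_mono hle).trans_lt ?_
  rw [lintegral_add_left measurable_const, lintegral_const, measure_univ, mul_one]
  refine ENNReal.add_lt_top.2 ⟨ENNReal.one_lt_top,
    (lintegral_enorm_rpow_le_of_growth hC hgrowth hβ μ).trans_lt ?_⟩
  have hβ0 : 0 ≤ β := by linarith
  exact ENNReal.mul_lt_top (ENNReal.mul_lt_top (ENNReal.rpow_lt_top_of_nonneg hβ0 (by simp))
    (ENNReal.rpow_lt_top_of_nonneg (by linarith) (by simp)))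
    (ENNReal.add_lt_top.2 ⟨ENNReal.one_lt_top, hμ⟩)

lemma enorm_integral_sub_integral_clip_le {h : ℝ → ℝ} (hcont : Continuous h) {C : ℝ} (hC : 0 < C)
    (hgrowth : ∀ x, |h x| ≤ C * (1 + |x|)) {β : ℝ} (hβ : 1 < β) {μ : Measure ℝ}
    [IsProbabilityMeasure μ] {M : ℝ} (hM : 0 < M) (hint : Integrable h μ) :
    ‖∫ x, h x ∂μ - ∫ x, clip h hcont M hM.le x ∂μ‖ₑ ≤ ENNReal.ofReal (M ^ (1 - β)) *
      (ENNReal.ofReal C ^ β * 2 ^ (β - 1) * (1 + ∫⁻ x, ‖x‖ₑ ^ β ∂μ)) := by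
  have hmeas : Measurable h := hcont.measurable
  rw [← integral_sub hint ((clip h hcont M hM.le).integrable μ)]
  refine (enorm_integral_le_lintegral_enorm _).trans ?_
  refine le_trans ?_ (mul_le_mul_right
    (lintegral_enorm_rpow_le_of_growth hC hgrowth hβ.le μ) _)
  rw [← lintegral_const_mul _ (by fun_prop)]
  refine lintegral_mono fun x => ?_
  rw [← ofReal_norm, ← ofReal_norm (h x), ENNReal.ofReal_rpow_of_nonneg (norm_nonneg _)
    (by linarith), ← ENNReal.ofReal_mul (by positivity)]
  exact ENNReal.ofReal_le_ofReal (abs_sub_clip_le (h x) hM hβ)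

/-- If the characteristic functions of random probability measures converge in `L¹` to that of
`μ` and their moments of order `β > 1` are bounded, then the integrals of a continuous function
of linear growth converge in `L¹`. -/
lemma tendsto_lintegral_integral_sub_of_growth {Ω : Type*} [MeasurableSpace Ω] {P : Measure Ω}
    [IsProbabilityMeasure P] {μ : Measure ℝ} [IsProbabilityMeasure μ]
    {η : ℕ → Kernel Ω ℝ} [∀ m, IsMarkovKernel (η m)]
    (hchar : ∀ t, Tendsto (fun m => ∫⁻ ω, ‖charFun (η m ω) t - charFun μ t‖ₑ ∂P) atTop (𝓝 0))
    {h : ℝ → ℝ} (hcont : Continuous h) {C : ℝ} (hC : 0 < C)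
    (hgrowth : ∀ x, |h x| ≤ C * (1 + |x|)) {β : ℝ} (hβ : 1 < β)
    {K : ℝ≥0∞} (hK : K < ∞) (hμK : ∫⁻ x, ‖x‖ₑ ^ β ∂μ ≤ K)
    (hηK : ∀ m, ∫⁻ ω, ∫⁻ x, ‖x‖ₑ ^ β ∂(η m ω) ∂P ≤ K)
    (hint : ∀ m ω, Integrable h (η m ω)) :
    Tendsto (fun m => ∫⁻ ω, ‖∫ x, h x ∂(η m ω) - ∫ x, h x ∂μ‖ₑ ∂P) atTop (𝓝 0) := by
  have hβ0 : 0 ≤ β := by linarith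
  set a := ENNReal.ofReal C ^ β * 2 ^ (β - 1)
  have ha : a < ∞ := ENNReal.mul_lt_top (ENNReal.rpow_lt_top_of_nonneg hβ0 (by simp))
    (ENNReal.rpow_lt_top_of_nonneg (by linarith) (by simp))
  have hμint : Integrable h μ := integrable_of_growth hcont hC hgrowth hβ.le (hμK.trans_lt hK)
  have hc : a * (1 + K) < ∞ := ENNReal.mul_lt_top ha (ENNReal.add_lt_top.2 ⟨by simp, hK⟩)
  -- The factor `2` accounts for truncating under `η m ω` and under `μ`; the total vanishes as `M →
  -- ∞` because `β > 1`. The level `M` is fixed before `m` is sent to infinity.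
  have hδ : Tendsto (fun M : ℝ => ENNReal.ofReal (M ^ (1 - β)) * (a * (1 + K)) * 2) atTop
      (𝓝 0) := by
    have h1 : Tendsto (fun M : ℝ => ENNReal.ofReal (M ^ (1 - β))) atTop (𝓝 0) := by
      rw [← ENNReal.ofReal_zero]
      refine ENNReal.tendsto_ofReal ?_
      simpa using tendsto_rpow_neg_atTop (y := β - 1) (by linarith)
    have h2 := ENNReal.Tendsto.mul_const (ENNReal.Tendsto.mul_const h1 (b := a * (1 + K))
      (.inr hc.ne)) (b := 2) (.inr (by simp))
    simpa using h2
  refine ENNReal.tendsto_nhds_zero.2 fun ε hε => ?_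
  have hε2 : 0 < ε / 2 := ENNReal.half_pos hε.ne'
  obtain ⟨M, hMε, hM⟩ := ((ENNReal.tendsto_nhds_zero.1 hδ (ε / 2) hε2).and
    (eventually_gt_atTop 0)).exists
  have hlim := tendsto_lintegral_of_tendsto_charFun hchar (clip h hcont M hM.le)
  filter_upwards [ENNReal.tendsto_nhds_zero.1 hlim (ε / 2) hε2] with m hm
  set f := clip h hcont M hM.le
  have hf : Measurable fun ω => ‖∫ x, f x ∂(η m ω) - ∫ x, f x ∂μ‖ₑ :=
    ((StronglyMeasurable.measurable (f.continuous.measurable.stronglyMeasurable.comp_measurable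
      measurable_snd).integral_kernel_prod_right').sub_const _).enorm
  have hmom : Measurable fun ω => ∫⁻ x, ‖x‖ₑ ^ β ∂(η m ω) :=
    Measurable.lintegral_kernel (by fun_prop)
  have htri (ω : Ω) : ‖∫ x, h x ∂(η m ω) - ∫ x, h x ∂μ‖ₑ ≤
      ‖∫ x, f x ∂(η m ω) - ∫ x, f x ∂μ‖ₑ + (ENNReal.ofReal (M ^ (1 - β)) *
        (a * (1 + ∫⁻ x, ‖x‖ₑ ^ β ∂(η m ω))) + ENNReal.ofReal (M ^ (1 - β)) * (a * (1 + K))) := by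
    have h1 := enorm_integral_sub_integral_clip_le hcont hC hgrowth hβ hM (hint m ω)
    have h2 : ‖∫ x, h x ∂μ - ∫ x, f x ∂μ‖ₑ ≤ ENNReal.ofReal (M ^ (1 - β)) * (a * (1 + K)) := by
      refine (enorm_integral_sub_integral_clip_le hcont hC hgrowth hβ hM hμint).trans ?_
      gcongr
    rw [show ∫ x, h x ∂(η m ω) - ∫ x, h x ∂μ = (∫ x, f x ∂(η m ω) - ∫ x, f x ∂μ) +
      ((∫ x, h x ∂(η m ω) - ∫ x, f x ∂(η m ω)) - (∫ x, h x ∂μ - ∫ x, f x ∂μ)) by ring]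
    refine (enorm_add_le _ _).trans ?_
    gcongr
    exact enorm_sub_le.trans (add_le_add h1 h2)
  refine (lintegral_mono htri).trans ?_
  rw [lintegral_add_left hf, lintegral_add_right _ measurable_const, lintegral_const, measure_univ,
    mul_one, lintegral_const_mul _ (by fun_prop), lintegral_const_mul _ (by fun_prop),
    lintegral_add_left measurable_const, lintegral_const, measure_univ, mul_one]
  refine (add_le_add hm (le_trans ?_ hMε)).trans_eq (ENNReal.add_halves ε)
  rw [mul_two]
  gcongr
  exact hηK m

/-! ### Integrability and conclusion -/

lemma MomentConditions.lintegral_enorm_Q_lt_top {ν : Measure BranchVec} {β : ℝ}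
    (hν : MomentConditions ν β) : ∫⁻ v, ‖BranchVec.Q v‖ₑ ^ β ∂ν < ∞ := by
  have hβ0 : 0 ≤ β := zero_le_one.trans hν.one_le
  convert hν.moment_Q using 3 with v
  rw [← ofReal_norm, ENNReal.ofReal_rpow_of_nonneg (norm_nonneg _) hβ0, Real.norm_eq_abs]

lemma MomentConditions.lintegral_enorm_C_lt_top {ν : Measure BranchVec} {β : ℝ}
    (hν : MomentConditions ν β) :
    ∫⁻ v, (∑ r ∈ Finset.range (BranchVec.N v), ‖BranchVec.C v r‖ₑ) ^ β ∂ν < ∞ := by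
  have hβ0 : 0 ≤ β := zero_le_one.trans hν.one_le
  convert hν.moment_C using 3 with v
  rw [← ENNReal.ofReal_rpow_of_nonneg (Finset.sum_nonneg fun _ _ => abs_nonneg _) hβ0,
    ENNReal.ofReal_sum_of_nonneg fun _ _ => abs_nonneg _]
  simp_rw [← ofReal_norm, Real.norm_eq_abs]

lemma integrable_empirical {m : ℕ} (x : Fin m → ℝ) {h : ℝ → ℝ} (hh : Measurable h) :
    Integrable h (empirical x) := by
  have : IsFiniteMeasure (uniformOn (Set.univ : Set (Fin m))) := by
    unfold uniformOn
    infer_instance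
  rw [empirical, integrable_map_measure hh.aestronglyMeasurable
    (measurable_of_countable x).aemeasurable]
  exact Integrable.of_finite

lemma integrable_integral_empirical {Ω : Type*} [MeasurableSpace Ω] {P : Measure Ω}
    [IsProbabilityMeasure P] {m : ℕ} [NeZero m] {X : Ω → Fin m → ℝ} (hX : Measurable X) {h : ℝ → ℝ}
    (hcont : Continuous h) {C : ℝ} (hC : 0 < C) (hgrowth : ∀ x, |h x| ≤ C * (1 + |x|)) {β : ℝ}
    (hβ : 1 ≤ β) (hmom : ∫⁻ ω, ∫⁻ x, ‖x‖ₑ ^ β ∂(empirical (X ω)) ∂P < ∞) :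
    Integrable (fun ω => ∫ x, h x ∂(empirical (X ω))) P := by
  have hm : Measurable fun x : ℝ => ‖x‖ₑ ^ β := by fun_prop
  have hXi (i : Fin m) : Measurable fun ω => X ω i := (measurable_pi_apply i).comp hX
  simp_rw [integral_empirical _ hcont.measurable]
  refine Integrable.const_mul (integrable_finsetSum _ fun i _ => ?_) _
  have : IsProbabilityMeasure (P.map fun ω => X ω i) :=
    Measure.isProbabilityMeasure_map (hXi i).aemeasurable
  refine Integrable.comp_measurable (g := h) ?_ (hXi i)
  refine integrable_of_growth hcont hC hgrowth hβ ?_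
  rw [lintegral_map hm (hXi i)]
  simp_rw [lintegral_empirical _ hm] at hmom
  rw [lintegral_const_mul _ (by fun_prop)] at hmom
  -- The factor `m⁻¹` is nonzero, so a finite averaged moment forces a finite moment for each single
  -- member.
  have hsum := ENNReal.lt_top_of_mul_ne_top_right hmom.ne (by simp)
  refine lt_of_le_of_lt (lintegral_mono fun ω => ?_) hsum
  exact Finset.single_le_sum (f := fun i => ‖X ω i‖ₑ ^ β) (fun _ _ => zero_le)
    (Finset.mem_univ i)

end BranchingBootstrap

open BranchingBootstrap

theorem mainTheorem2
    (ν : Measure BranchingBootstrap.BranchVec) [IsProbabilityMeasure ν]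
    (β : ℝ) (hβ : 1 < β) (hν : BranchingBootstrap.MomentConditions ν β)
    -- a weighted branching process with generic branching vector of law `ν`
    {Ω' : Type*} [MeasurableSpace Ω'] (P' : Measure Ω') [IsProbabilityMeasure P']
    (V : List ℕ → Ω' → BranchingBootstrap.BranchVec)
    (hV : BranchingBootstrap.IsBranchingFamily P' ν V)
    -- for every pool size `m`, a run of the algorithm; no assumption relates different `m`
    {Ω : Type*} [MeasurableSpace Ω] (P : Measure Ω) [IsProbabilityMeasure P]
    (B : (m : ℕ) → ℕ → Fin m → Ω → BranchingBootstrap.BranchVec)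
    (S : (m : ℕ) → ℕ → Fin m → ℕ → Ω → Fin m)
    (hBS : ∀ m, BranchingBootstrap.IsBootstrapInput P ν (B m) (S m))
    (h : ℝ → ℝ) (hcont : Continuous h) (C : ℝ) (hC : 0 < C)
    (hgrowth : ∀ x, |h x| ≤ C * (1 + |x|)) (k : ℕ) :
    Integrable (fun ω' => h (BranchingBootstrap.treeSum (fun i => V i ω') k)) P' ∧
    (∀ m, Integrable (BranchingBootstrap.poolAverage h k (B m) (S m)) P) ∧
    Tendsto (fun m => ∫ ω, |BranchingBootstrap.poolAverage h k (B m) (S m) ω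
        - ∫ ω', h (BranchingBootstrap.treeSum (fun i => V i ω') k) ∂P'| ∂P) atTop (𝓝 0) ∧
    TendstoInMeasure P (fun m => BranchingBootstrap.poolAverage h k (B m) (S m)) atTop
      (fun _ => ∫ ω', h (BranchingBootstrap.treeSum (fun i => V i ω') k) ∂P') := by

  have hgen := exists_moment_bound ν hβ.le hν.lintegral_enorm_Q_lt_top
    hν.lintegral_enorm_C_lt_top k
  obtain ⟨K, hK, hTK, hPK⟩ := hgen
  have hmTree : Measurable fun ω' => treeSum (fun i => V i ω') k :=
    (measurable_treeSum k).comp (measurable_pi_lambda _ hV.measurable)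
  have hTint : Integrable h (treeLaw ν k) :=
    integrable_of_growth hcont hC hgrowth hβ.le (hTK.trans_lt hK)
  have hlim_eq : ∫ ω', h (treeSum (fun i => V i ω') k) ∂P' = ∫ x, h x ∂(treeLaw ν k) := by
    rw [← hV.map_treeSum, integral_map hmTree.aemeasurable hcont.measurable.aestronglyMeasurable]
  have hTreeInt : Integrable (fun ω' => h (treeSum (fun i => V i ω') k)) P' := by
    rw [← hV.map_treeSum] at hTint
    exact hTint.comp_measurable hmTree
  rw [hlim_eq]
  set inp : (m : ℕ) → Ω → ℕ × Fin (m + 1) → BranchVec × (ℕ → Fin (m + 1)) :=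
    fun m ω p => (B (m + 1) p.1 p.2 ω, fun r => S (m + 1) p.1 p.2 r ω)
  have hinp (m : ℕ) : Measurable (inp m) := measurable_pi_lambda _ fun p =>
    ((hBS (m + 1)).measurable_B _ _).prodMk
      (measurable_pi_lambda _ fun r => (hBS (m + 1)).measurable_S _ _ _)
  set X : (m : ℕ) → Ω → Fin (m + 1) → ℝ := fun m ω => inputPool k (inp m ω)
  have hX (m : ℕ) : Measurable (X m) := (measurable_inputPool k).comp (hinp m)
  -- Only the law of the input matters, separately for each `m`; this transfers the estimates from
  -- the canonical product space to `Ω`.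
  have htransfer (m : ℕ) {g : (Fin (m + 1) → ℝ) → ℝ≥0∞} (hg : Measurable g) :
      ∫⁻ ω, g (X m ω) ∂P = ∫⁻ Z, g (inputPool k Z) ∂(Measure.infinitePi
        fun _ : ℕ × Fin (m + 1) => inputLaw (m + 1) ν) := by
    rw [← (hBS (m + 1)).map_input]
    exact (lintegral_map (hg.comp (measurable_inputPool k)) (hinp m)).symm
  set η : ℕ → Kernel Ω ℝ := fun m => (empiricalKernel (m + 1)).comap (X m) (hX m)
  have havg (m : ℕ) : poolAverage h k (B (m + 1)) (S (m + 1)) =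
      fun ω => ∫ x, h x ∂(empirical (X m ω)) := by
    ext ω
    rw [integral_empirical _ hcont.measurable, poolAverage, one_div]
    rfl
  have hmom (m : ℕ) : ∫⁻ ω, ∫⁻ x, ‖x‖ₑ ^ β ∂(empirical (X m ω)) ∂P ≤ K := by
    rw [htransfer m (measurable_lintegral_empirical (by fun_prop))]
    exact hPK m
  have hint (m : ℕ) : Integrable (poolAverage h k (B m) (S m)) P := by
    cases m with
    -- For the empty pool the sum is empty and the average is `0`.
    | zero => exact (integrable_zero Ω ℝ P).congr (.of_forall fun ω => by simp [poolAverage])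
    | succ m =>
      rw [havg]
      exact integrable_integral_empirical (hX m) hcont hC hgrowth hβ.le ((hmom m).trans_lt hK)
  have hconv : Tendsto (fun m => ∫⁻ ω, ‖poolAverage h k (B m) (S m) ω -
      ∫ x, h x ∂(treeLaw ν k)‖ₑ ∂P) atTop (𝓝 0) := by
    -- Shifting the index discards the empty pool, whose empirical measure is not a probability
    -- measure.
    rw [← tendsto_add_atTop_iff_nat 1]
    simp_rw [havg]
    refine tendsto_lintegral_integral_sub_of_growth (η := η) (fun t => ?_) hcont hC hgrowth hβ hK
      hTK hmom (fun m ω => integrable_empirical (X m ω) hcont.measurable)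
    refine (tendsto_lintegral_charFun_inputPool_sub ν k t).congr fun m => ?_
    exact (htransfer m (measurable_enorm_charFun_empirical_sub t _)).symm
  refine ⟨hTreeInt, hint, ?_, ?_⟩
  · have h1 := (ENNReal.tendsto_toReal ENNReal.zero_ne_top).comp hconv
    refine h1.congr fun m => ?_
    have h2 := ofReal_integral_norm_eq_lintegral_enorm ((hint m).sub
      (integrable_const (∫ x, h x ∂(treeLaw ν k))))
    simp only [Pi.sub_apply] at h2
    rw [Function.comp_apply, ← h2, ENNReal.toReal_ofReal (integral_nonneg fun _ => norm_nonneg _)]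
    rfl
  · refine tendstoInMeasure_of_tendsto_eLpNorm one_ne_zero
      (fun m => (hint m).aestronglyMeasurable) aestronglyMeasurable_const ?_
    simp_rw [eLpNorm_one_eq_lintegral_enorm]
    exact hconv
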